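/- Let $n,d\ge 1$ be integers. For a positive definite matrix $A=U\,\mathrm{diag}(\lambda_1,\dots,\lambda_d)\,U^*$ ($U$ unitary) put $A^s=U\,\mathrm{diag}(\lambda_1^s,\dots,\lambda_d^s)\,U^*$, and let $\|\cdot\|$ be the operator norm of complex $d\times d$ matrices with respect to the Euclidean norm $|\cdot|$ on $\mathbb C^d$. A matrix weight is a map $W:\mathbb R^n\to M_d(\mathbb C)$ with locally integrable entries such that $W(x)$ is nonnegative definite for every $x$ and invertible for almost every $x$. Cubes have sides parallel to the axes, and $2^iQ$ is the cube with the same centre as $Q$ and side length $2^i\ell(Q)$. For $p>1$ let $p'=p/(p-1)$. For $p>0$ and cubes $Q,R$ let $$\Phi_p^W(Q,R)=\begin{cases}\operatorname*{ess\,sup}_{y\in R}\ \frac1{|Q|}\int_Q\|W^{1/p}(x)W^{-1/p}(y)\|^p\,dx,& 0<p\le 1,\\[4pt] \frac1{|Q|}\int_Q\Big(\frac1{|R|}\int_R\|W^{1/p}(x)W^{-1/p}(y)\|^{p'}\,dy\Big)^{p/p'}dx,& 1<p<\infty.\end{cases}$$ A matrix weight $W$ belongs to $\mathcal A_p$ if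 $\sup_Q\Phi_p^W(Q,Q)<\infty$, and it has the $\mathcal A_p$-dimension $\delta\in\mathbb R$ if there is a constant $C>0$ such that $\Phi_p^W(Q,2^iQ)\le C2^{i\delta}$ for all cubes $Q$ and all integers $i\ge 0$. For $j\in\mathbb Z$, $k\in\mathbb Z^n$ let $Q_{j,k}=\prod_{i=1}^n[2^{-j}k_i,2^{-j}(k_i+1))$, let $\mathcal D_j=\{Q_{j,k}:k\in\mathbb Z^n\}$, and let $W(Q)=\int_Q\|W(y)\|\,dy$. For $1\le p<t<r<\infty$ the Bourgain–Morrey space $M_p^{t,r}(W)$ consists of the measurable $f:\mathbb R^n\to\mathbb C^d$ with $\int_K|W^{1/p}f|^p\,dx<\infty$ for every compact $K$ and $$\|f\|_{M_p^{t,r}(W)}=\Big(\sum_{j\in\mathbb Z}\sum_{k\in\mathbb Z^n}\Big[W(Q_{j,k})^{1/t-1/p}\Big(\int_{Q_{j,k}}|W^{1/p}(y)f(y)|^p\,dy\Big)^{1/p}\Big]^r\Big)^{1/r}<\infty .$$ For $a\in\mathbb Z$ the dyadic average operator is $$E_{d,a}f(x)=\sum_{Q\in\mathcal D_{-a}}\frac{\chi_Q(x)}{|Q|}\int_Q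 f(y)\,dy .$$ **Theorem.** Let $1\le p<t<r<\infty$, and let $W\in\mathcal A_p$ have the $\mathcal A_p$-dimension $\tilde d\in[0,n)$. If $p=1$, let $\tilde\beta=n$; if $p>1$, let $W^{-1/(p-1)}$ have the $\mathcal A_{p'}$-dimension $\tilde{\tilde d}$, and let $\tilde\beta=n+\tilde{\tilde d}\,p/p'$. Assume that $$-\frac{nr}{p}+\frac{\tilde d\,r}{p}+n-\tilde\beta r\Big(\frac1t-\frac1p\Big)<0 .$$ Then a set $\mathcal F\subset M_p^{t,r}(W)$ is totally bounded in $M_p^{t,r}(W)$ (that is, for every $\epsilon>0$ there is a finite set $N\subset M_p^{t,r}(W)$ such that every $f\in\mathcal F$ satisfies $\|f-g\|_{M_p^{t,r}(W)}<\epsilon$ for some $g\in N$) if and only if the following three conditions hold: (i) $\displaystyle\sup_{f\in\mathcal F}\|f\|_{M_p^{t,r}(W)}<\infty$; (ii) $\displaystyle\lim_{R\to\infty}\sup_{f\in\mathcal F}\|f\,\chi_{\mathbb R^n\setminus B(0,R)}\|_{M_p^{t,r}(W)}=0$; (iii) $\displaystyle\lim_{a\to-\infty,\ a\in\mathbb Z}\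 \sup_{f\in\mathcal F}\|f-E_{d,a}f\|_{M_p^{t,r}(W)}=0$. -/

import Mathlib

open MeasureTheory Filter Topology
open scoped ENNReal ComplexOrder

noncomputable section

namespace BourgainMorrey

/-! ### Matrices -/

/-- The operator norm of a complex `d × d` matrix acting on `ℂ^d` with the Euclidean norm. -/
def opNorm {d : ℕ} (A : Matrix (Fin d) (Fin d) ℂ) : ℝ :=
  ‖Matrix.toEuclideanCLM (n := Fin d) (𝕜 := ℂ) A‖

/-- The real power `A ^ s` of a Hermitian matrix through the spectral theorem: if
`A = U diag(λ₁, …, λ_d) U*` then `matPow s A = U diag(λ₁ ^ s, …, λ_d ^ s) U*`.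
It is used for positive definite `A`; a matrix weight is positive definite almost everywhere. -/
def matPow {d : ℕ} (s : ℝ) (A : Matrix (Fin d) (Fin d) ℂ) : Matrix (Fin d) (Fin d) ℂ :=
  cfc (fun x : ℝ => x ^ s) A

/-- A matrix weight on `ℝ^n`. -/
structure IsMatrixWeight {n d : ℕ}
    (W : EuclideanSpace ℝ (Fin n) → Matrix (Fin d) (Fin d) ℂ) : Prop where
  posSemidef : ∀ x, (W x).PosSemidef
  isUnit : ∀ᵐ x, IsUnit (W x)
  locallyIntegrable : ∀ i j, LocallyIntegrable (fun x => W x i j)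

/-! ### Cubes and the matrix class `𝒜_p` -/

/-- The cube with centre `c` and side length `l`, with sides parallel to the axes. -/
def cube {n : ℕ} (c : EuclideanSpace ℝ (Fin n)) (l : ℝ) : Set (EuclideanSpace ℝ (Fin n)) :=
  {x | ∀ i, c i - l / 2 ≤ x i ∧ x i < c i + l / 2}

/-- For `p ≤ 1`: `esssup_{y ∈ R} ⨍_{x ∈ Q} ‖W^{1/p}(x) W^{-1/p}(y)‖^p`.
For `p > 1`: `⨍_{x ∈ Q} (⨍_{y ∈ R} ‖W^{1/p}(x) W^{-1/p}(y)‖^{p'})^{p/p'}`, `p' = p / (p - 1)`. -/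
def apQuantity {n d : ℕ} (p : ℝ) (W : EuclideanSpace ℝ (Fin n) → Matrix (Fin d) (Fin d) ℂ)
    (Q R : Set (EuclideanSpace ℝ (Fin n))) : ℝ≥0∞ :=
  if p ≤ 1 then
    essSup (fun y => ⨍⁻ x,
      ENNReal.ofReal (opNorm (matPow (1 / p) (W x) * matPow (-(1 / p)) (W y))) ^ p
      ∂(volume.restrict Q)) (volume.restrict R)
  else
    ⨍⁻ x, (⨍⁻ y,
      ENNReal.ofReal (opNorm (matPow (1 / p) (W x) * matPow (-(1 / p)) (W y)))
        ^ (p / (p - 1)) ∂(volume.restrict R)) ^ (p / (p / (p - 1))) ∂(volume.restrict Q)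

/-- The matrix Muckenhoupt class `𝒜_p`. -/
def MatrixAp {n d : ℕ} (p : ℝ)
    (W : EuclideanSpace ℝ (Fin n) → Matrix (Fin d) (Fin d) ℂ) : Prop :=
  IsMatrixWeight W ∧
    ∃ C : ℝ, 0 < C ∧ ∀ (c : EuclideanSpace ℝ (Fin n)) (l : ℝ), 0 < l →
      apQuantity p W (cube c l) (cube c l) ≤ ENNReal.ofReal C

/-- `W` has the `𝒜_p`-dimension `δ`. -/
def HasApDimension {n d : ℕ} (p : ℝ)
    (W : EuclideanSpace ℝ (Fin n) → Matrix (Fin d) (Fin d) ℂ) (δ : ℝ) : Prop :=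
  ∃ C : ℝ, 0 < C ∧ ∀ (c : EuclideanSpace ℝ (Fin n)) (l : ℝ), 0 < l → ∀ i : ℕ,
    apQuantity p W (cube c l) (cube c (2 ^ i * l)) ≤ ENNReal.ofReal (C * 2 ^ ((i : ℝ) * δ))

/-- The exponent `β̃`, equal to `n` if `p = 1` and to `n + δ' p / p'` if `p > 1`. -/
def betaTilde (n : ℕ) (p δ' : ℝ) : ℝ :=
  if p = 1 then (n : ℝ) else (n : ℝ) + δ' * p / (p / (p - 1))

/-! ### Matrix weighted Bourgain–Morrey spaces -/

/-- The dyadic cube `∏ᵢ [2^{-j} mᵢ, 2^{-j} (mᵢ + 1))`. -/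
def dyadicCube {n : ℕ} (j : ℤ) (m : Fin n → ℤ) : Set (EuclideanSpace ℝ (Fin n)) :=
  {x | ∀ i, (2 : ℝ) ^ (-j) * (m i : ℝ) ≤ x i ∧ x i < (2 : ℝ) ^ (-j) * ((m i : ℝ) + 1)}

/-- `∫_E |W^{1/p}(x) f(x)|^p dx`. -/
def weightedIntegral {n d : ℕ} (p : ℝ)
    (W : EuclideanSpace ℝ (Fin n) → Matrix (Fin d) (Fin d) ℂ)
    (f : EuclideanSpace ℝ (Fin n) → EuclideanSpace ℂ (Fin d))
    (E : Set (EuclideanSpace ℝ (Fin n))) : ℝ≥0∞ :=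
  ∫⁻ x in E, ENNReal.ofReal
    ‖Matrix.toEuclideanCLM (n := Fin d) (𝕜 := ℂ) (matPow (1 / p) (W x)) (f x)‖ ^ p

/-- `W(E) = ∫_E ‖W(x)‖ dx`. -/
def weightMass {n d : ℕ} (W : EuclideanSpace ℝ (Fin n) → Matrix (Fin d) (Fin d) ℂ)
    (E : Set (EuclideanSpace ℝ (Fin n))) : ℝ≥0∞ :=
  ∫⁻ x in E, ENNReal.ofReal (opNorm (W x))

/-- The Bourgain–Morrey norm (for finite `r`), with the value `∞` allowed. -/
def bmNorm {n d : ℕ} (p t r : ℝ) (W : EuclideanSpace ℝ (Fin n) → Matrix (Fin d) (Fin d) ℂ)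
    (f : EuclideanSpace ℝ (Fin n) → EuclideanSpace ℂ (Fin d)) : ℝ≥0∞ :=
  (∑' q : ℤ × (Fin n → ℤ),
    (weightMass W (dyadicCube q.1 q.2) ^ (1 / t - 1 / p) *
      weightedIntegral p W f (dyadicCube q.1 q.2) ^ (1 / p)) ^ r) ^ (1 / r)

/-- Membership of a function in the Bourgain–Morrey space `M_p^{t,r}(W)`. -/
structure MemBM {n d : ℕ} (p t r : ℝ)
    (W : EuclideanSpace ℝ (Fin n) → Matrix (Fin d) (Fin d) ℂ)
    (f : EuclideanSpace ℝ (Fin n) → EuclideanSpace ℂ (Fin d)) : Prop where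
  aestronglyMeasurable : AEStronglyMeasurable f
  locallyFinite : ∀ K : Set (EuclideanSpace ℝ (Fin n)), IsCompact K →
    weightedIntegral p W f K < ∞
  norm_lt_top : bmNorm p t r W f < ∞

/-- Total boundedness in `M_p^{t,r}(W)`: for every `ε > 0` there is a finite `ε`-net in the
space. (Functions are not identified when equal almost everywhere; the norm of a difference
does not see the identification.) -/
def TotallyBoundedBM {n d : ℕ} (p t r : ℝ)
    (W : EuclideanSpace ℝ (Fin n) → Matrix (Fin d) (Fin d) ℂ)
    (F : Set (EuclideanSpace ℝ (Fin n) → EuclideanSpace ℂ (Fin d))) : Prop :=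
  ∀ ε : ℝ, 0 < ε → ∃ N : Set (EuclideanSpace ℝ (Fin n) → EuclideanSpace ℂ (Fin d)),
    N.Finite ∧ (∀ g ∈ N, MemBM p t r W g) ∧
      ∀ f ∈ F, ∃ g ∈ N, bmNorm p t r W (f - g) < ENNReal.ofReal ε

/-- The dyadic average operator `E_{d,a} f = ∑_{Q ∈ 𝒟_{-a}} χ_Q |Q|⁻¹ ∫_Q f`, where the cubes
of `𝒟_{-a}` have side length `2^a`; at each point exactly one term can be nonzero. -/
def dyadicAverage {n d : ℕ} (a : ℤ)
    (f : EuclideanSpace ℝ (Fin n) → EuclideanSpace ℂ (Fin d)) :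
    EuclideanSpace ℝ (Fin n) → EuclideanSpace ℂ (Fin d) :=
  fun x => ∑' m : Fin n → ℤ,
    (dyadicCube (-a) m).indicator (fun _ => ⨍ y in dyadicCube (-a) m, f y) x

end BourgainMorrey

end

open BourgainMorrey

/-!
The proof reduces total boundedness to a statement about the operators `E_a`: they are bounded on
`M_p^{t,r}(W)` uniformly in `a`, and `E_a g → g` as `a → -∞` for every `g` in the space.

Both facts come from one domination, `MatrixAp.cubeTerm_dyadicAverage_le`. Let `T_Q(f)` be the
contribution of the dyadic cube `Q` to the `r`-th power of the norm. Then
`T_Q(E_a g) ≤ ∑_k c_k T_{Q^{(k)}}(g)`, where `Q^{(k)}` is the `k`-th dyadic ancestor of `Q`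
and `c` does not depend on `a`. If `Q` is at least as large as the scale `2^a`, the term `k = 0`
suffices, because averaging over subcubes of `Q` is bounded in `L^p(W)`. If `Q` is smaller, `E_a g`
is constant on `Q`, equal to the average of `g` over an ancestor; the `𝒜_p`-dimension compares the
size of this constant on `Q` with the integral of `g` over the ancestor
(`HasApDimension.lintegral_average_le`), and the weight of the ancestor exceeds that of `Q`
by at most a multiple of `2^{kβ̃}` (`MatrixAp.weightMass_ancestor_le`). A cube has `2^{kn}`
descendants in generation `k`, and the condition on the exponents says exactly that
`∑_k c_k 2^{kn}` is a convergent geometric series. Summation over `Q` gives the uniform bound;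
dominated convergence over `Q` reduces `E_a g → g` to a single cube, where it follows from the
density of bounded continuous functions in `L^p(W)`.

A totally bounded set is then treated by passing to a finite net. Conversely, (ii) and (iii)
approximate `f` uniformly on the set by `E_a (f χ_B)` with a fixed scale and a fixed ball `B`.
These functions are bounded in norm by (i) and lie in a finite-dimensional space of step functions,
so they have finite nets (`Seminorm.exists_finite_net`). The net consists of elements of the
space, and it is not needed that indicators of cubes belong to it.
-/

open scoped BoundedContinuousFunction

noncomputable section

namespace BourgainMorrey

/-! ### Powers of positive definite matrices -/

section Matrices
open scoped Matrix.Norms.L2Operator MatrixOrder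

variable {d : ℕ} {A : Matrix (Fin d) (Fin d) ℂ}

theorem opNorm_eq_norm (A : Matrix (Fin d) (Fin d) ℂ) : opNorm A = ‖A‖ := rfl

theorem matPow_eq_rpow (hA : A.PosDef) (s : ℝ) : matPow s A = A ^ s :=
  (CFC.rpow_eq_cfc_real (hA.isStrictlyPositive.nonneg)).symm

theorem matPow_neg_mul_matPow (hA : A.PosDef) (s : ℝ) : matPow (-s) A * matPow s A = 1 := by
  rw [matPow_eq_rpow hA, matPow_eq_rpow hA]
  exact CFC.rpow_neg_mul_rpow s hA.isStrictlyPositive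

theorem posDef_matPow (hA : A.PosDef) (s : ℝ) : (matPow s A).PosDef := by
  rw [matPow_eq_rpow hA]
  exact Matrix.isStrictlyPositive_iff_posDef.1 (IsStrictlyPositive.rpow A s hA.isStrictlyPositive)

theorem matPow_matPow (hA : A.PosDef) {s : ℝ} (hs : s ≠ 0) (u : ℝ) :
    matPow u (matPow s A) = matPow (s * u) A := by
  rw [matPow_eq_rpow (posDef_matPow hA s), matPow_eq_rpow hA, matPow_eq_rpow hA]
  exact CFC.rpow_rpow A s u hs hA.isStrictlyPositive

theorem opNorm_matPow (hA : A.PosDef) {s : ℝ} (hs : 0 < s) :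
    opNorm (matPow s A) = opNorm A ^ s := by
  rw [matPow_eq_rpow hA, opNorm_eq_norm, opNorm_eq_norm]
  exact CFC.norm_rpow A hs hA.isStrictlyPositive.nonneg

theorem opNorm_mul_comm_of_posDef {B : Matrix (Fin d) (Fin d) ℂ} (hA : A.PosDef)
    (hB : B.PosDef) : opNorm (A * B) = opNorm (B * A) := by
  rw [opNorm_eq_norm, opNorm_eq_norm, ← Matrix.l2_opNorm_conjTranspose, Matrix.conjTranspose_mul,
    hA.isHermitian.eq, hB.isHermitian.eq]

theorem opNorm_mul_le (A B : Matrix (Fin d) (Fin d) ℂ) : opNorm (A * B) ≤ opNorm A * opNorm B := by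
  simp only [opNorm_eq_norm]
  exact norm_mul_le A B

theorem continuousOn_matPow (s : ℝ) :
    ContinuousOn (fun A : Matrix (Fin d) (Fin d) ℂ => matPow s A) {A | A.PosDef} := by
  have h := CFC.continuousOn_rpow (A := Matrix (Fin d) (Fin d) ℂ) s
  refine (h.mono fun A hA => Matrix.PosDef.isStrictlyPositive hA).congr fun A hA => ?_
  exact matPow_eq_rpow hA s

theorem continuous_toEuclideanCLM :
    Continuous (Matrix.toEuclideanCLM (n := Fin d) (𝕜 := ℂ)) := by
  exact LinearMap.continuous_of_finiteDimensional
    (Matrix.toEuclideanCLM (n := Fin d) (𝕜 := ℂ)).toAlgEquiv.toLinearMap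

end Matrices

/-! ### Matrix weights: measurability and pointwise bounds -/

section Weights
variable {n d : ℕ} {W : EuclideanSpace ℝ (Fin n) → Matrix (Fin d) (Fin d) ℂ}

theorem IsMatrixWeight.ae_posDef (hW : IsMatrixWeight W) : ∀ᵐ x, (W x).PosDef := by
  filter_upwards [hW.isUnit] with x hx
  exact (Matrix.PosSemidef.posDef_iff_isUnit (hW.posSemidef x)).2 hx

theorem IsMatrixWeight.aestronglyMeasurable (hW : IsMatrixWeight W) :
    AEStronglyMeasurable W := by
  have h : W = fun x => ∑ i, ∑ j, Matrix.single i j (W x i j) := by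
    funext x
    exact Matrix.matrix_eq_sum_single (W x)
  rw [h]
  refine Finset.aestronglyMeasurable_fun_sum _ fun i _ =>
    Finset.aestronglyMeasurable_fun_sum _ fun j _ => ?_
  have hc : Continuous fun c : ℂ => (Matrix.single i j c : Matrix (Fin d) (Fin d) ℂ) :=
    continuous_matrix fun i' j' => by
      by_cases h : i = i' ∧ j = j' <;>
        simp only [Matrix.single_apply, h, and_self, if_true, if_false] <;> fun_prop
  exact hc.comp_aestronglyMeasurable (hW.locallyIntegrable i j).aestronglyMeasurable

open scoped Matrix.Norms.L2Operator MatrixOrder in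
theorem measurableSet_posDef [MeasurableSpace (Matrix (Fin d) (Fin d) ℂ)]
    [OpensMeasurableSpace (Matrix (Fin d) (Fin d) ℂ)] :
    MeasurableSet {A : Matrix (Fin d) (Fin d) ℂ | A.PosDef} := by
  have h : {A : Matrix (Fin d) (Fin d) ℂ | A.PosDef} = {A | IsUnit A} ∩ {A | 0 ≤ A} := by
    ext A
    rw [Set.mem_ofPred_eq, ← Matrix.isStrictlyPositive_iff_posDef]
    exact and_comm
  rw [h]
  exact (Units.isOpen.measurableSet).inter isClosed_Ici.measurableSet

theorem IsMatrixWeight.aestronglyMeasurable_matPow (hW : IsMatrixWeight W) (s : ℝ) :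
    AEStronglyMeasurable
      (fun x => Matrix.toEuclideanCLM (n := Fin d) (𝕜 := ℂ) (matPow s (W x))) := by
  refine continuous_toEuclideanCLM.comp_aestronglyMeasurable ?_
  let _ : MeasurableSpace (Matrix (Fin d) (Fin d) ℂ) := borel _
  have : BorelSpace (Matrix (Fin d) (Fin d) ℂ) := ⟨rfl⟩
  have : SecondCountableTopology (Matrix (Fin d) (Fin d) ℂ) :=
    inferInstanceAs (SecondCountableTopology (Fin d → Fin d → ℂ))
  classical
  have hm : Measurable ({A : Matrix (Fin d) (Fin d) ℂ | A.PosDef}.piecewise (matPow s)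
      fun _ => 0) :=
    (continuousOn_matPow s).measurable_piecewise continuousOn_const
      measurableSet_posDef
  have h := hm.comp_aemeasurable hW.aestronglyMeasurable.aemeasurable
  refine AEMeasurable.aestronglyMeasurable (h.congr ?_)
  filter_upwards [hW.ae_posDef] with x hx
  exact Set.piecewise_eq_of_mem _ _ _ hx

/-- The pointwise weighted size `|W^{1/p}(x) f(x)|`. -/
def wSize (p : ℝ) (W : EuclideanSpace ℝ (Fin n) → Matrix (Fin d) (Fin d) ℂ)
    (f : EuclideanSpace ℝ (Fin n) → EuclideanSpace ℂ (Fin d)) (x : EuclideanSpace ℝ (Fin n)) :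
    ℝ≥0∞ :=
  ‖Matrix.toEuclideanCLM (n := Fin d) (𝕜 := ℂ) (matPow (1 / p) (W x)) (f x)‖ₑ

theorem weightedIntegral_eq (p : ℝ) (W : EuclideanSpace ℝ (Fin n) → Matrix (Fin d) (Fin d) ℂ)
    (f : EuclideanSpace ℝ (Fin n) → EuclideanSpace ℂ (Fin d)) (E : Set (EuclideanSpace ℝ (Fin n))) :
    weightedIntegral p W f E = ∫⁻ x in E, wSize p W f x ^ p := by
  simp only [weightedIntegral, wSize, ofReal_norm]

/-- The extended norm of the matrix `W^{1/p}(x) W^{-1/p}(y)`. -/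
def crossNorm (p : ℝ) (W : EuclideanSpace ℝ (Fin n) → Matrix (Fin d) (Fin d) ℂ)
    (x y : EuclideanSpace ℝ (Fin n)) : ℝ≥0∞ :=
  ENNReal.ofReal (opNorm (matPow (1 / p) (W x) * matPow (-(1 / p)) (W y)))

theorem crossNorm_eq (p : ℝ) (W : EuclideanSpace ℝ (Fin n) → Matrix (Fin d) (Fin d) ℂ)
    (x y : EuclideanSpace ℝ (Fin n)) :
    crossNorm p W x y = ‖Matrix.toEuclideanCLM (n := Fin d) (𝕜 := ℂ) (matPow (1 / p) (W x)) *
      Matrix.toEuclideanCLM (n := Fin d) (𝕜 := ℂ) (matPow (-(1 / p)) (W y))‖ₑ := by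
  rw [crossNorm, opNorm, ofReal_norm, map_mul]

theorem IsMatrixWeight.aemeasurable_wSize (hW : IsMatrixWeight W) (p : ℝ)
    {f : EuclideanSpace ℝ (Fin n) → EuclideanSpace ℂ (Fin d)} (hf : AEStronglyMeasurable f) :
    AEMeasurable (wSize p W f) := by
  have hc : Continuous fun z : (EuclideanSpace ℂ (Fin d) →L[ℂ] EuclideanSpace ℂ (Fin d)) ×
      EuclideanSpace ℂ (Fin d) => z.1 z.2 := isBoundedBilinearMap_apply.continuous
  exact (hc.comp_aestronglyMeasurable ((hW.aestronglyMeasurable_matPow (1 / p)).prodMk hf)).enorm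

theorem IsMatrixWeight.aemeasurable_crossNorm (hW : IsMatrixWeight W) (p : ℝ) :
    AEMeasurable (Function.uncurry (crossNorm p W)) (volume.prod volume) := by
  have h : Function.uncurry (crossNorm p W) = fun z =>
      ‖Matrix.toEuclideanCLM (n := Fin d) (𝕜 := ℂ) (matPow (1 / p) (W z.1)) *
        Matrix.toEuclideanCLM (n := Fin d) (𝕜 := ℂ) (matPow (-(1 / p)) (W z.2))‖ₑ := by
    funext z
    exact crossNorm_eq p W z.1 z.2
  rw [h]
  exact ((hW.aestronglyMeasurable_matPow (1 / p)).comp_fst.mul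
    (hW.aestronglyMeasurable_matPow (-(1 / p))).comp_snd).enorm

theorem enorm_apply_le_crossNorm_mul (p : ℝ) {x y : EuclideanSpace ℝ (Fin n)}
    (hy : (W y).PosDef) (f : EuclideanSpace ℝ (Fin n) → EuclideanSpace ℂ (Fin d)) :
    ‖Matrix.toEuclideanCLM (n := Fin d) (𝕜 := ℂ) (matPow (1 / p) (W x)) (f y)‖ₑ ≤
      crossNorm p W x y * wSize p W f y := by
  have h := matPow_neg_mul_matPow hy (1 / p)
  have h1 : Matrix.toEuclideanCLM (n := Fin d) (𝕜 := ℂ) (matPow (1 / p) (W x)) (f y) =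
      (Matrix.toEuclideanCLM (n := Fin d) (𝕜 := ℂ) (matPow (1 / p) (W x)) *
        Matrix.toEuclideanCLM (n := Fin d) (𝕜 := ℂ) (matPow (-(1 / p)) (W y)))
      (Matrix.toEuclideanCLM (n := Fin d) (𝕜 := ℂ) (matPow (1 / p) (W y)) (f y)) := by
    rw [← mul_apply_eq_comp, mul_assoc, ← map_mul, h, map_one, mul_one]
  rw [h1, crossNorm_eq]
  exact ContinuousLinearMap.le_opENorm _ _

theorem wSize_add_le (p : ℝ) (f g : EuclideanSpace ℝ (Fin n) → EuclideanSpace ℂ (Fin d))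
    (x : EuclideanSpace ℝ (Fin n)) : wSize p W (f + g) x ≤ wSize p W f x + wSize p W g x := by
  simp only [wSize, Pi.add_apply, map_add]
  exact enorm_add_le _ _

theorem wSize_neg (p : ℝ) (f : EuclideanSpace ℝ (Fin n) → EuclideanSpace ℂ (Fin d))
    (x : EuclideanSpace ℝ (Fin n)) : wSize p W (-f) x = wSize p W f x := by
  simp only [wSize, Pi.neg_apply, map_neg, enorm_neg]

theorem wSize_smul (p : ℝ) (c : ℂ) (f : EuclideanSpace ℝ (Fin n) → EuclideanSpace ℂ (Fin d))
    (x : EuclideanSpace ℝ (Fin n)) : wSize p W (c • f) x = ‖c‖ₑ * wSize p W f x := by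
  simp only [wSize, Pi.smul_apply, map_smul, enorm_smul]

theorem wSize_indicator_le (p : ℝ) (s : Set (EuclideanSpace ℝ (Fin n)))
    (f : EuclideanSpace ℝ (Fin n) → EuclideanSpace ℂ (Fin d))
    (x : EuclideanSpace ℝ (Fin n)) : wSize p W (s.indicator f) x ≤ wSize p W f x := by
  by_cases hx : x ∈ s <;> simp [wSize, hx]

theorem ofReal_opNorm_matPow_rpow {A : Matrix (Fin d) (Fin d) ℂ} (hA : A.PosDef) {p : ℝ}
    (hp : 0 < p) :
    ENNReal.ofReal (opNorm (matPow (1 / p) A)) ^ p = ENNReal.ofReal (opNorm A) := by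
  have h0 : 0 ≤ opNorm A := norm_nonneg _
  rw [opNorm_matPow hA (by positivity), ENNReal.ofReal_rpow_of_nonneg (by positivity) hp.le,
    ← Real.rpow_mul h0, one_div_mul_cancel hp.ne', Real.rpow_one]

theorem wSize_rpow_le {p : ℝ} (hp : 0 < p) {x : EuclideanSpace ℝ (Fin n)} (hx : (W x).PosDef)
    (f : EuclideanSpace ℝ (Fin n) → EuclideanSpace ℂ (Fin d)) :
    wSize p W f x ^ p ≤ ENNReal.ofReal (opNorm (W x)) * ‖f x‖ₑ ^ p := by
  rw [← ofReal_opNorm_matPow_rpow hx hp, ← ENNReal.mul_rpow_of_nonneg _ _ hp.le]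
  gcongr
  rw [opNorm, ofReal_norm]
  exact ContinuousLinearMap.le_opENorm _ _

theorem IsMatrixWeight.aemeasurable_opNorm (hW : IsMatrixWeight W) :
    AEMeasurable fun x => ENNReal.ofReal (opNorm (W x)) := by
  simp only [opNorm, ofReal_norm]
  exact (continuous_toEuclideanCLM.comp_aestronglyMeasurable hW.aestronglyMeasurable).enorm

theorem IsMatrixWeight.weightMass_lt_top (hW : IsMatrixWeight W)
    {K : Set (EuclideanSpace ℝ (Fin n))}
    (hK : IsCompact K) : weightMass W K < ∞ := by
  -- the operator norm is controlled by the entries, which are locally integrable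
  have hb : ∃ C : ℝ, 0 ≤ C ∧ ∀ A : Matrix (Fin d) (Fin d) ℂ, opNorm A ≤ C * ∑ i, ∑ j, ‖A i j‖ := by
    refine ⟨∑ i, ∑ j, opNorm (Matrix.single i j (1 : ℂ) : Matrix (Fin d) (Fin d) ℂ),
      Finset.sum_nonneg fun i _ => Finset.sum_nonneg fun j _ => norm_nonneg _, fun A => ?_⟩
    have hA : Matrix.toEuclideanCLM (n := Fin d) (𝕜 := ℂ) A =
        ∑ i, ∑ j, A i j • Matrix.toEuclideanCLM (n := Fin d) (𝕜 := ℂ) (Matrix.single i j 1) := by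
      conv_lhs => rw [Matrix.matrix_eq_sum_single A]
      simp only [map_sum]
      refine Finset.sum_congr rfl fun i _ => Finset.sum_congr rfl fun j _ => ?_
      rw [← map_smul, Matrix.smul_single, smul_eq_mul, mul_one]
    rw [opNorm, hA]
    refine (norm_sum_le _ _).trans ?_
    rw [Finset.sum_mul]
    refine Finset.sum_le_sum fun i _ => (norm_sum_le _ _).trans ?_
    rw [Finset.sum_mul]
    refine Finset.sum_le_sum fun j _ => ?_
    rw [norm_smul, mul_comm]
    refine mul_le_mul_of_nonneg_left ?_ (norm_nonneg _)
    exact (Finset.single_le_sum (f := fun j => ‖A i j‖) (fun _ _ => norm_nonneg _)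
      (Finset.mem_univ j)).trans (Finset.single_le_sum (f := fun i => ∑ j, ‖A i j‖)
        (fun _ _ => Finset.sum_nonneg fun _ _ => norm_nonneg _) (Finset.mem_univ i))
  obtain ⟨C, _, hC⟩ := hb
  have hint : Integrable (fun x => C * ∑ i, ∑ j, ‖W x i j‖) (volume.restrict K) :=
    Integrable.const_mul (integrable_finsetSum _ fun i _ => integrable_finsetSum _ fun j _ =>
      ((hW.locallyIntegrable i j).integrableOn_isCompact hK).norm) C
  refine lt_of_le_of_lt (lintegral_mono fun x => ENNReal.ofReal_le_ofReal (hC (W x))) ?_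
  exact hint.lintegral_lt_top

theorem IsMatrixWeight.weightMass_ne_zero (hW : IsMatrixWeight W) (hd : 0 < d)
    {E : Set (EuclideanSpace ℝ (Fin n))} (hE : volume E ≠ 0) : weightMass W E ≠ 0 := by
  intro h
  rw [weightMass, lintegral_eq_zero_iff' hW.aemeasurable_opNorm.restrict] at h
  have hz : ∀ᵐ x ∂(volume.restrict E), False := by
    filter_upwards [h, ae_restrict_of_ae hW.ae_posDef] with x hx hpd
    have h0 : opNorm (W x) = 0 :=
      le_antisymm (ENNReal.ofReal_eq_zero.1 hx) (norm_nonneg _)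
    rw [opNorm, norm_eq_zero, map_eq_zero_iff _ (EquivLike.injective _)] at h0
    have : Nonempty (Fin d) := ⟨⟨0, hd⟩⟩
    have := hpd.isUnit
    rw [h0] at this
    exact not_isUnit_zero this
  have h1 : volume.restrict E = 0 := by simpa [Filter.eventually_false_iff_eq_bot] using hz
  exact hE (Measure.restrict_eq_zero.1 h1)

end Weights

/-! ### Cubes, dyadic cubes and their ancestors -/

section Cubes
variable {n : ℕ}

theorem cube_eq_preimage (c : EuclideanSpace ℝ (Fin n)) (l : ℝ) :
    cube c l = WithLp.ofLp ⁻¹' Set.pi Set.univ fun i => Set.Ico (c i - l / 2) (c i + l / 2) := by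
  ext x
  simp [cube]

theorem volume_cube (c : EuclideanSpace ℝ (Fin n)) (l : ℝ) :
    volume (cube c l) = ENNReal.ofReal l ^ n := by
  rw [cube_eq_preimage, (PiLp.volume_preserving_ofLp (Fin n)).measure_preimage
    (MeasurableSet.univ_pi fun i => measurableSet_Ico).nullMeasurableSet, Real.volume_pi_Ico]
  simp

theorem isBounded_cube (c : EuclideanSpace ℝ (Fin n)) (l : ℝ) :
    Bornology.IsBounded (cube c l) := by
  rw [cube_eq_preimage]
  refine (PiLp.antilipschitzWith_ofLp 2 (fun _ : Fin n => ℝ)).isBounded_preimage ?_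
  exact Bornology.IsBounded.pi fun i => Metric.isBounded_Ico _ _

/-- The index of the dyadic cube of side length `2^{-j}` that contains `x`. -/
def dyadicIndex (j : ℤ) (x : EuclideanSpace ℝ (Fin n)) : Fin n → ℤ :=
  fun i => ⌊(2 : ℝ) ^ j * x i⌋

theorem mem_dyadicCube_iff {j : ℤ} {m : Fin n → ℤ} {x : EuclideanSpace ℝ (Fin n)} :
    x ∈ dyadicCube j m ↔ dyadicIndex j x = m := by
  have h2 : (0 : ℝ) < 2 ^ j := by positivity
  simp only [dyadicCube, Set.mem_ofPred_eq, dyadicIndex, funext_iff, Int.floor_eq_iff, zpow_neg]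
  refine forall_congr' fun i => and_congr ?_ ?_
  · rw [inv_mul_le_iff₀ h2]
  · rw [lt_inv_mul_iff₀ h2]

theorem measurable_dyadicIndex (j : ℤ) :
    Measurable (dyadicIndex j : EuclideanSpace ℝ (Fin n) → Fin n → ℤ) := by
  refine measurable_pi_lambda _ fun i => Int.measurable_floor.comp ?_
  fun_prop

theorem measurableSet_dyadicCube (j : ℤ) (m : Fin n → ℤ) :
    MeasurableSet (dyadicCube j m) := by
  have h : dyadicCube j m = dyadicIndex j ⁻¹' {m} := by
    ext x
    exact mem_dyadicCube_iff
  rw [h]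
  exact measurable_dyadicIndex j (measurableSet_singleton m)

/-- The centre of the dyadic cube with parameters `j` and `m`. -/
def dyadicCenter (j : ℤ) (m : Fin n → ℤ) : EuclideanSpace ℝ (Fin n) :=
  WithLp.toLp 2 fun i => (2 : ℝ) ^ (-j) * ((m i : ℝ) + 1 / 2)

theorem dyadicCube_eq_cube (j : ℤ) (m : Fin n → ℤ) :
    dyadicCube j m = cube (dyadicCenter j m) ((2 : ℝ) ^ (-j)) := by
  ext x
  simp only [dyadicCube, cube, dyadicCenter, Set.mem_ofPred_eq]
  refine forall_congr' fun i => ?_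
  ring_nf

theorem isBounded_dyadicCube (j : ℤ) (m : Fin n → ℤ) : Bornology.IsBounded (dyadicCube j m) := by
  rw [dyadicCube_eq_cube]
  exact isBounded_cube _ _

/-- The index of the ancestor, `k` generations up, of the dyadic cube with index `m`. -/
def ancestor (k : ℕ) (m : Fin n → ℤ) : Fin n → ℤ := fun i => m i / ((2 ^ k : ℕ) : ℤ)

theorem dyadicIndex_sub (j : ℤ) (k : ℕ) (x : EuclideanSpace ℝ (Fin n)) :
    dyadicIndex (j - k) x = ancestor k (dyadicIndex j x) := by
  funext i
  simp only [dyadicIndex, ancestor]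
  rw [← Int.floor_div_natCast]
  congr 1
  rw [zpow_sub₀ two_ne_zero, zpow_natCast]
  push_cast
  ring

theorem dyadicCube_subset_ancestor (j : ℤ) (k : ℕ) (m : Fin n → ℤ) :
    dyadicCube j m ⊆ dyadicCube (j - k) (ancestor k m) := by
  intro x hx
  rw [mem_dyadicCube_iff] at hx ⊢
  rw [dyadicIndex_sub, hx]

theorem dyadicCenter_mem (j : ℤ) (m : Fin n → ℤ) : dyadicCenter j m ∈ dyadicCube j m := by
  have h2 : (0 : ℝ) < 2 ^ (-j) := by positivity
  intro i
  simp only [dyadicCenter]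
  constructor <;> nlinarith

/-- A dyadic ancestor need not lie in the concentric dilate of the same side length, but it lies
in the dilate of twice its side length. -/
theorem ancestor_subset_cube (j : ℤ) (k : ℕ) (m : Fin n → ℤ) :
    dyadicCube (j - k) (ancestor k m) ⊆
      cube (dyadicCenter j m) ((2 : ℝ) ^ (k + 1) * (2 : ℝ) ^ (-j)) := by
  intro x hx i
  have hc := dyadicCube_subset_ancestor j k m (dyadicCenter_mem j m) i
  have hx := hx i
  have h2 : (2 : ℝ) ^ (-(j - k)) = 2 ^ k * 2 ^ (-j) := by
    rw [neg_sub, sub_eq_add_neg, zpow_add₀ two_ne_zero, zpow_natCast]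
  rw [h2] at hc hx
  rw [pow_succ]
  constructor <;> nlinarith

theorem iUnion_dyadicCube_ancestor (j : ℤ) (k : ℕ) (m : Fin n → ℤ) :
    dyadicCube j m = ⋃ m' : {m' : Fin n → ℤ // ancestor k m' = m}, dyadicCube (j + k) m'.1 := by
  ext x
  simp only [Set.mem_iUnion, mem_dyadicCube_iff, Subtype.exists, exists_prop]
  have := dyadicIndex_sub (j + k) k x
  rw [add_sub_cancel_right] at this
  constructor
  · intro h
    exact ⟨_, by rw [← this, h], rfl⟩
  · rintro ⟨m', h1, h2⟩
    rw [this, h2, h1]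

theorem pairwise_disjoint_dyadicCube (j : ℤ) :
    Pairwise (Function.onFun Disjoint (dyadicCube (n := n) j)) := by
  intro a b hab
  refine Set.disjoint_left.2 fun x hx hx' => hab ?_
  rw [mem_dyadicCube_iff] at hx hx'
  rw [← hx, hx']

theorem lintegral_dyadicCube_eq_tsum (j : ℤ) (k : ℕ) (m : Fin n → ℤ)
    (F : EuclideanSpace ℝ (Fin n) → ℝ≥0∞) :
    ∫⁻ x in dyadicCube j m, F x =
      ∑' m' : {m' : Fin n → ℤ // ancestor k m' = m}, ∫⁻ x in dyadicCube (j + k) m'.1, F x := by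
  rw [iUnion_dyadicCube_ancestor j k m]
  refine lintegral_iUnion (fun m' => measurableSet_dyadicCube _ _) (fun a b hab => ?_) F
  exact pairwise_disjoint_dyadicCube _ (fun h => hab (Subtype.ext h))

/-- Each cube has `2 ^ (k n)` descendants `k` generations down. -/
theorem tsum_ancestor (k : ℕ) (F : (Fin n → ℤ) → ℝ≥0∞) :
    ∑' m, F (ancestor k m) = 2 ^ (k * n) * ∑' m, F m := by
  -- division with remainder by `2 ^ k` in each coordinate
  let e : (Fin n → ℤ) ≃ (Fin n → ℤ) × (Fin n → Fin (2 ^ k)) :=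
    (Equiv.piCongrRight fun _ => Int.divModEquiv (2 ^ k)).trans
      (Equiv.arrowProdEquivProdArrow (Fin n) (fun _ => ℤ) fun _ => Fin (2 ^ k))
  have h : ∀ m, F (ancestor k m) = (fun z : (Fin n → ℤ) × (Fin n → Fin (2 ^ k)) => F z.1) (e m) := by
    intro m
    rfl
  simp_rw [h]
  rw [e.tsum_eq (fun z : (Fin n → ℤ) × (Fin n → Fin (2 ^ k)) => F z.1), ENNReal.tsum_prod']
  simp only [tsum_fintype, Finset.sum_const, Finset.card_univ, Fintype.card_pi, Fintype.card_fin,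
    Finset.prod_const, nsmul_eq_mul]
  rw [ENNReal.tsum_mul_left]
  push_cast
  rw [pow_mul]

theorem tsum_ancestor_level (k : ℕ) (F : ℤ × (Fin n → ℤ) → ℝ≥0∞) :
    ∑' q : ℤ × (Fin n → ℤ), F (q.1 - k, ancestor k q.2) = 2 ^ (k * n) * ∑' q, F q := by
  rw [ENNReal.tsum_prod', ENNReal.tsum_prod', ← ENNReal.tsum_mul_left]
  simp_rw [fun j : ℤ => tsum_ancestor k fun m => F (j - k, m)]
  exact (Equiv.subRight (k : ℤ)).tsum_eq fun j => (2 : ℝ≥0∞) ^ (k * n) * ∑' m, F (j, m)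

end Cubes

/-! ### Averaging bounds encoded by the quantity `Φ_p^W(Q, R)` -/

section Kernels
variable {α β : Type*} [MeasurableSpace α] [MeasurableSpace β] {μ : Measure α} {ν : Measure β}
  [SFinite ν]

theorem lintegral_kernel_le [SFinite μ] {N : α → β → ℝ≥0∞} {S : β → ℝ≥0∞}
    (hN : AEMeasurable (Function.uncurry N) (μ.prod ν)) (hS : AEMeasurable S ν) {K : ℝ≥0∞}
    (hK : ∀ᵐ y ∂ν, ∫⁻ x, N x y ∂μ ≤ K) :
    ∫⁻ x, ∫⁻ y, N x y * S y ∂ν ∂μ ≤ K * ∫⁻ y, S y ∂ν := by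
  rw [lintegral_lintegral_swap (hN.mul hS.comp_snd), ← lintegral_const_mul'' K hS]
  refine lintegral_mono_ae ?_
  filter_upwards [hK, hN.prod_swap.aestronglyMeasurable.prodMk_left] with y hy hm
  have hm' : AEMeasurable (fun x => N x y) μ := hm.aemeasurable
  rw [lintegral_mul_const'' _ hm']
  gcongr

/-- Hölder's inequality in the inner variable, integrated in the outer one. The factor on the left of
the product is the mixed norm of the kernel that appears in `apQuantity` for `p > 1`. -/
theorem lintegral_kernel_rpow_le {p q : ℝ} (hpq : p.HolderConjugate q) {N : α → β → ℝ≥0∞}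
    {S : β → ℝ≥0∞} (hN : AEMeasurable (Function.uncurry N) (μ.prod ν)) (hS : AEMeasurable S ν) :
    ∫⁻ x, (∫⁻ y, N x y * S y ∂ν) ^ p ∂μ ≤
      (∫⁻ x, (∫⁻ y, N x y ^ q ∂ν) ^ (p / q) ∂μ) * ∫⁻ y, S y ^ p ∂ν := by
  have hm : AEMeasurable (fun x => (∫⁻ y, N x y ^ q ∂ν) ^ (p / q)) μ :=
    ((hN.pow_const q).lintegral_prod_right').pow_const _
  rw [← lintegral_mul_const'' _ hm]
  refine lintegral_mono_ae ?_
  filter_upwards [hN.aestronglyMeasurable.prodMk_left] with x hx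
  have h := ENNReal.lintegral_mul_le_Lp_mul_Lq ν hpq.symm hx.aemeasurable hS
  calc (∫⁻ y, N x y * S y ∂ν) ^ p
      ≤ ((∫⁻ y, N x y ^ q ∂ν) ^ (1 / q) * (∫⁻ y, S y ^ p ∂ν) ^ (1 / p)) ^ p :=
        ENNReal.rpow_le_rpow h hpq.nonneg
    _ = _ := by
        rw [ENNReal.mul_rpow_of_nonneg _ _ hpq.nonneg, ← ENNReal.rpow_mul, ← ENNReal.rpow_mul,
          one_div_mul_cancel hpq.ne_zero, ENNReal.rpow_one, one_div_mul_eq_div]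

end Kernels

section Averages
variable {n d : ℕ} {W : EuclideanSpace ℝ (Fin n) → Matrix (Fin d) (Fin d) ℂ}
  {Q R : Set (EuclideanSpace ℝ (Fin n))} {p : ℝ}

/-- For `p > 1`, the integral in `Φ_p^W(Q, R)` without its normalising factors. -/
theorem lintegral_crossNorm_eq (hp : 1 < p) (hQ0 : volume Q ≠ 0) (hQ : volume Q ≠ ∞)
    (hR0 : volume R ≠ 0) (hR : volume R ≠ ∞) :
    ∫⁻ x in Q, (∫⁻ y in R, crossNorm p W x y ^ (p / (p - 1))) ^ (p / (p / (p - 1))) =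
      volume Q * volume R ^ (p - 1) * apQuantity p W Q R := by
  have hpp : p / (p / (p - 1)) = p - 1 := by
    have : p - 1 ≠ 0 := by linarith
    field_simp
  have h1 : apQuantity p W Q R = (volume Q)⁻¹ * ((volume R ^ (p - 1))⁻¹ *
      ∫⁻ x in Q, (∫⁻ y in R, crossNorm p W x y ^ (p / (p - 1))) ^ (p / (p / (p - 1)))) := by
    rw [apQuantity, if_neg (not_le.2 hp)]
    simp only [laverage, lintegral_smul_measure, Measure.restrict_apply_univ, smul_eq_mul,
      ENNReal.mul_rpow_of_nonneg _ _ (show 0 ≤ p / (p / (p - 1)) by rw [hpp]; linarith)]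
    rw [lintegral_const_mul', hpp, ENNReal.inv_rpow]
    · rfl
    · rw [hpp]
      exact ENNReal.rpow_ne_top_of_nonneg (by linarith) (ENNReal.inv_ne_top.2 hR0)
  have hR' : volume R ^ (p - 1) ≠ ∞ := ENNReal.rpow_ne_top_of_nonneg (by linarith) hR
  have hR0' : volume R ^ (p - 1) ≠ 0 := by
    rw [Ne, ENNReal.rpow_eq_zero_iff_of_pos (by linarith)]
    exact hR0
  rw [h1, ← mul_assoc, mul_right_comm (volume Q), ENNReal.mul_inv_cancel hQ0 hQ, one_mul,
    ← mul_assoc, ENNReal.mul_inv_cancel hR0' hR', one_mul]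

/-- For `p = 1`, the essential supremum in `Φ_1^W(Q, R)` as a bound for almost every `y ∈ R`. -/
theorem ae_lintegral_crossNorm_le (hQ0 : volume Q ≠ 0) (hQ : volume Q ≠ ∞) :
    ∀ᵐ y ∂(volume.restrict R), ∫⁻ x in Q, crossNorm 1 W x y ≤ volume Q * apQuantity 1 W Q R := by
  have h := ae_le_essSup (f := fun y => ⨍⁻ x in Q, crossNorm 1 W x y ∂volume)
    (μ := volume.restrict R)
  have h1 : apQuantity 1 W Q R =
      essSup (fun y => ⨍⁻ x in Q, crossNorm 1 W x y ∂volume) (volume.restrict R) := by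
    rw [apQuantity, if_pos le_rfl]
    simp only [ENNReal.rpow_one]
    rfl
  rw [h1]
  filter_upwards [h] with y hy
  rw [setLAverage_eq, ENNReal.div_le_iff_le_mul (Or.inl hQ0) (Or.inl hQ)] at hy
  rwa [mul_comm]

/-- The `L^p` mapping property of averages encoded by `Φ_p^W(Q, R)`. -/
theorem lintegral_lintegral_rpow_le (hW : IsMatrixWeight W) (hp : 1 ≤ p)
    (hQ0 : volume Q ≠ 0) (hQ : volume Q ≠ ∞) (hR0 : volume R ≠ 0) (hR : volume R ≠ ∞)
    {g : EuclideanSpace ℝ (Fin n) → EuclideanSpace ℂ (Fin d)} (hg : AEStronglyMeasurable g) :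
    ∫⁻ x in Q, (∫⁻ y in R,
      ‖Matrix.toEuclideanCLM (n := Fin d) (𝕜 := ℂ) (matPow (1 / p) (W x)) (g y)‖ₑ) ^ p ≤
      volume Q * volume R ^ (p - 1) * apQuantity p W Q R * ∫⁻ y in R, wSize p W g y ^ p := by
  have hpt : ∀ x, ∫⁻ y in R,
      ‖Matrix.toEuclideanCLM (n := Fin d) (𝕜 := ℂ) (matPow (1 / p) (W x)) (g y)‖ₑ ≤
      ∫⁻ y in R, crossNorm p W x y * wSize p W g y := fun x => by
    refine lintegral_mono_ae (ae_restrict_of_ae ?_)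
    filter_upwards [hW.ae_posDef] with y hy
    exact enorm_apply_le_crossNorm_mul p hy g
  have hN : AEMeasurable (Function.uncurry (crossNorm p W))
      ((volume.restrict Q).prod (volume.restrict R)) := by
    rw [Measure.prod_restrict]
    exact (hW.aemeasurable_crossNorm p).restrict
  have hS := (hW.aemeasurable_wSize p hg).restrict (s := R)
  refine (lintegral_mono fun x => ENNReal.rpow_le_rpow (hpt x) (by linarith)).trans ?_
  rcases hp.eq_or_lt with rfl | hp
  · simp only [sub_self, ENNReal.rpow_zero, mul_one, ENNReal.rpow_one]
    exact lintegral_kernel_le hN hS (ae_lintegral_crossNorm_le hQ0 hQ)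
  · rw [← lintegral_crossNorm_eq hp hQ0 hQ hR0 hR]
    exact lintegral_kernel_rpow_le (Real.HolderConjugate.conjExponent hp) hN hS

/-- The same bound for a function supported in a subset `P` of `R`. It is applied to a dyadic ancestor
`P` of `Q` inside a concentric dilate `R` of `Q`. -/
theorem lintegral_lintegral_rpow_subset_le (hW : IsMatrixWeight W) (hp : 1 ≤ p)
    (hQ0 : volume Q ≠ 0) (hQ : volume Q ≠ ∞) (hR0 : volume R ≠ 0) (hR : volume R ≠ ∞)
    {P : Set (EuclideanSpace ℝ (Fin n))} (hPm : MeasurableSet P) (hPR : P ⊆ R)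
    {g : EuclideanSpace ℝ (Fin n) → EuclideanSpace ℂ (Fin d)} (hg : AEStronglyMeasurable g) :
    ∫⁻ x in Q, (∫⁻ y in P,
      ‖Matrix.toEuclideanCLM (n := Fin d) (𝕜 := ℂ) (matPow (1 / p) (W x)) (g y)‖ₑ) ^ p ≤
      volume Q * volume R ^ (p - 1) * apQuantity p W Q R * weightedIntegral p W g P := by
  have h := lintegral_lintegral_rpow_le hW hp hQ0 hQ hR0 hR (hg.indicator hPm)
  have h1 : ∀ x, ∫⁻ y in R, ‖Matrix.toEuclideanCLM (n := Fin d) (𝕜 := ℂ) (matPow (1 / p) (W x))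
      (P.indicator g y)‖ₑ = ∫⁻ y in P,
      ‖Matrix.toEuclideanCLM (n := Fin d) (𝕜 := ℂ) (matPow (1 / p) (W x)) (g y)‖ₑ := fun x => by
    rw [← Set.inter_eq_left.2 hPR, ← Measure.restrict_restrict hPm, ← lintegral_indicator hPm,
      Set.inter_eq_left.2 hPR]
    refine lintegral_congr fun y => ?_
    by_cases hy : y ∈ P <;> simp [hy]
  have h2 : ∫⁻ y in R, wSize p W (P.indicator g) y ^ p = weightedIntegral p W g P := by
    rw [weightedIntegral_eq, ← Set.inter_eq_left.2 hPR, ← Measure.restrict_restrict hPm,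
      ← lintegral_indicator hPm, Set.inter_eq_left.2 hPR]
    refine lintegral_congr fun y => ?_
    by_cases hy : y ∈ P <;> simp [hy, wSize, show 0 < p by linarith]
  simp_rw [h1] at h
  rwa [h2] at h

end Averages

/-! ### Averages over ancestors, and the growth of the weight -/

section DyadicEstimates
variable {n d : ℕ} {W : EuclideanSpace ℝ (Fin n) → Matrix (Fin d) (Fin d) ℂ} {p : ℝ}

theorem two_rpow_mul (x y : ℝ) : (2 : ℝ≥0∞) ^ x * 2 ^ y = 2 ^ (x + y) :=
  (ENNReal.rpow_add x y two_ne_zero ENNReal.ofNat_ne_top).symm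

theorem two_rpow_ne_top (x : ℝ) : (2 : ℝ≥0∞) ^ x ≠ ∞ :=
  ENNReal.rpow_ne_top_of_ne_zero two_ne_zero ENNReal.ofNat_ne_top

theorem two_rpow_ne_zero (x : ℝ) : (2 : ℝ≥0∞) ^ x ≠ 0 :=
  (ENNReal.rpow_pos (by norm_num) ENNReal.ofNat_ne_top).ne'

theorem ofReal_two_rpow (x : ℝ) : ENNReal.ofReal ((2 : ℝ) ^ x) = 2 ^ x := by
  rw [← ENNReal.ofReal_rpow_of_pos two_pos]
  norm_num

theorem volume_cube_two_rpow (c : EuclideanSpace ℝ (Fin n)) (x : ℝ) :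
    volume (cube c ((2 : ℝ) ^ x)) = 2 ^ (x * n) := by
  rw [volume_cube, ofReal_two_rpow, ENNReal.rpow_mul, ENNReal.rpow_natCast]

theorem volume_dyadicCube_eq_two_rpow (j : ℤ) (m : Fin n → ℤ) :
    volume (dyadicCube j m) = 2 ^ (-(j : ℝ) * n) := by
  rw [dyadicCube_eq_cube, ← volume_cube_two_rpow (dyadicCenter j m), ← Real.rpow_intCast]
  push_cast
  rfl

/-- The concentric dilate of the dyadic cube `Q_{j,m}` that contains its ancestor `k` generations
up. -/
def dilatedCube (j : ℤ) (k : ℕ) (m : Fin n → ℤ) : Set (EuclideanSpace ℝ (Fin n)) :=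
  cube (dyadicCenter j m) ((2 : ℝ) ^ (k + 1) * (2 : ℝ) ^ (-j))

theorem volume_dilatedCube (j : ℤ) (k : ℕ) (m : Fin n → ℤ) :
    volume (dilatedCube j k m) = 2 ^ (((k : ℝ) + 1 - j) * n) := by
  have : (2 : ℝ) ^ (k + 1) * (2 : ℝ) ^ (-j) = 2 ^ ((k : ℝ) + 1 - j) := by
    rw [sub_eq_add_neg, Real.rpow_add two_pos, ← Real.rpow_intCast, ← Real.rpow_natCast]
    push_cast
    rfl
  rw [dilatedCube, this, volume_cube_two_rpow]

theorem HasApDimension.dyadic {δ : ℝ} (hδ : HasApDimension p W δ) :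
    ∃ C : ℝ≥0∞, C ≠ ∞ ∧ ∀ (j : ℤ) (k : ℕ) (m : Fin n → ℤ),
      apQuantity p W (dyadicCube j m) (dilatedCube j k m) ≤ C * 2 ^ ((k : ℝ) * δ) := by
  obtain ⟨C, hC, h⟩ := hδ
  refine ⟨ENNReal.ofReal C * 2 ^ δ, ENNReal.mul_ne_top ENNReal.ofReal_ne_top (two_rpow_ne_top _),
    fun j k m => ?_⟩
  have := h (dyadicCenter j m) ((2 : ℝ) ^ (-j)) (by positivity) (k + 1)
  rw [← dyadicCube_eq_cube, ENNReal.ofReal_mul hC.le, ofReal_two_rpow] at this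
  refine this.trans_eq ?_
  rw [mul_assoc, two_rpow_mul]
  push_cast
  ring_nf

theorem volume_dyadicCube_ne_zero (j : ℤ) (m : Fin n → ℤ) : volume (dyadicCube j m) ≠ 0 := by
  rw [volume_dyadicCube_eq_two_rpow]
  exact two_rpow_ne_zero _

theorem volume_dyadicCube_ne_top (j : ℤ) (m : Fin n → ℤ) : volume (dyadicCube j m) ≠ ∞ := by
  rw [volume_dyadicCube_eq_two_rpow]
  exact two_rpow_ne_top _

theorem volume_dilatedCube_ne_zero (j : ℤ) (k : ℕ) (m : Fin n → ℤ) :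
    volume (dilatedCube j k m) ≠ 0 := by
  rw [volume_dilatedCube]
  exact two_rpow_ne_zero _

theorem volume_dilatedCube_ne_top (j : ℤ) (k : ℕ) (m : Fin n → ℤ) :
    volume (dilatedCube j k m) ≠ ∞ := by
  rw [volume_dilatedCube]
  exact two_rpow_ne_top _

theorem enorm_clm_average_le {F : Type*} [NormedAddCommGroup F] [NormedSpace ℂ F] [CompleteSpace F]
    (L : F →L[ℂ] F) (g : EuclideanSpace ℝ (Fin n) → F) (P : Set (EuclideanSpace ℝ (Fin n)))
    (hP0 : volume P ≠ 0) :
    ‖L (⨍ y in P, g y)‖ₑ ≤ (volume P)⁻¹ * ∫⁻ y in P, ‖L (g y)‖ₑ := by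
  by_cases hg : IntegrableOn g P
  · rw [setAverage_eq, ← algebraMap_smul ℂ ((volume.real P)⁻¹), map_smul,
      ← L.integral_comp_comm hg, algebraMap_smul, enorm_smul]
    gcongr
    · rw [Real.enorm_of_nonneg (by positivity)]
      by_cases hP : volume P = ∞
      · simp [hP, measureReal_def]
      · rw [ENNReal.ofReal_inv_of_pos, ofReal_measureReal hP]
        exact ENNReal.toReal_pos hP0 hP
    · exact enorm_integral_le_lintegral_enorm _
  -- the average of a non-integrable function is zero
  · rw [setAverage_eq, integral_undef hg]
    simp

/-- Averages over an ancestor of a dyadic cube, measured on that cube. -/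
theorem HasApDimension.lintegral_average_le (hW : IsMatrixWeight W) (hp : 1 ≤ p) {δ : ℝ}
    (hδ : HasApDimension p W δ) :
    ∃ C : ℝ≥0∞, C ≠ ∞ ∧ ∀ (j : ℤ) (k : ℕ) (m : Fin n → ℤ)
      (g : EuclideanSpace ℝ (Fin n) → EuclideanSpace ℂ (Fin d)), AEStronglyMeasurable g →
      weightedIntegral p W (fun _ => ⨍ y in dyadicCube (j - k) (ancestor k m), g y)
        (dyadicCube j m) ≤
      C * 2 ^ ((k : ℝ) * (δ - n)) *
        weightedIntegral p W g (dyadicCube (j - k) (ancestor k m)) := by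
  obtain ⟨C, hC, h⟩ := hδ.dyadic
  refine ⟨C * 2 ^ (n * (p - 1)), ENNReal.mul_ne_top hC (two_rpow_ne_top _), fun j k m g hg => ?_⟩
  have hp0 : 0 ≤ p := by linarith
  set P := dyadicCube (j - k) (ancestor k m) with hP
  have h1 := lintegral_lintegral_rpow_subset_le hW hp (volume_dyadicCube_ne_zero j m)
    (volume_dyadicCube_ne_top j m) (volume_dilatedCube_ne_zero j k m)
    (volume_dilatedCube_ne_top j k m) (measurableSet_dyadicCube _ _)
    (ancestor_subset_cube j k m) hg
  have hPv : (volume P)⁻¹ = 2 ^ (-(((k : ℝ) - j) * n)) := by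
    rw [hP, volume_dyadicCube_eq_two_rpow, ENNReal.rpow_neg]
    push_cast
    ring_nf
  calc weightedIntegral p W (fun _ => ⨍ y in P, g y) (dyadicCube j m)
      ≤ ∫⁻ x in dyadicCube j m, ((volume P)⁻¹) ^ p * (∫⁻ y in P,
          ‖Matrix.toEuclideanCLM (n := Fin d) (𝕜 := ℂ) (matPow (1 / p) (W x)) (g y)‖ₑ) ^ p := by
        rw [weightedIntegral_eq]
        refine lintegral_mono fun x => ?_
        rw [← ENNReal.mul_rpow_of_nonneg _ _ hp0]
        exact ENNReal.rpow_le_rpow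
          (enorm_clm_average_le _ _ _ (volume_dyadicCube_ne_zero _ _)) hp0
    _ = ((volume P)⁻¹) ^ p * ∫⁻ x in dyadicCube j m, (∫⁻ y in P,
          ‖Matrix.toEuclideanCLM (n := Fin d) (𝕜 := ℂ) (matPow (1 / p) (W x)) (g y)‖ₑ) ^ p := by
        refine lintegral_const_mul' _ _ ?_
        rw [hPv, ← ENNReal.rpow_mul]
        exact two_rpow_ne_top _
    _ ≤ ((volume P)⁻¹) ^ p * (volume (dyadicCube j m) * volume (dilatedCube j k m) ^ (p - 1) *
          (C * 2 ^ ((k : ℝ) * δ)) * weightedIntegral p W g P) := by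
        gcongr
        refine h1.trans ?_
        gcongr
        exact h j k m
    _ = _ := by
        have hc : ∀ a b c e I : ℝ≥0∞, a * (b * c * (C * e) * I) = C * (a * b * c * e) * I :=
          fun a b c e I => by ring
        rw [hPv, volume_dyadicCube_eq_two_rpow, volume_dilatedCube, ← ENNReal.rpow_mul,
          ← ENNReal.rpow_mul, hc, two_rpow_mul, two_rpow_mul, two_rpow_mul,
          mul_assoc C (2 ^ _) (2 ^ _), two_rpow_mul]
        ring_nf

/-- A function with finite weighted integral over a dyadic cube is integrable there: by the averaging
bound, `W^{1/p}(x) f` is integrable for almost every fixed `x`, and `W^{1/p}(x)` is invertible. -/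
theorem HasApDimension.integrableOn (hW : IsMatrixWeight W) (hp : 1 ≤ p) {δ : ℝ}
    (hδ : HasApDimension p W δ) {g : EuclideanSpace ℝ (Fin n) → EuclideanSpace ℂ (Fin d)}
    (hg : AEStronglyMeasurable g) {j : ℤ} {m : Fin n → ℤ}
    (h : weightedIntegral p W g (dyadicCube j m) ≠ ∞) : IntegrableOn g (dyadicCube j m) := by
  obtain ⟨C, hC, hC'⟩ := hδ.dyadic
  have hsub : dyadicCube j m ⊆ dilatedCube j 0 m := by
    have := ancestor_subset_cube j 0 m
    refine Set.Subset.trans ?_ this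
    simpa using dyadicCube_subset_ancestor j 0 m
  have h1 := lintegral_lintegral_rpow_subset_le hW hp (volume_dyadicCube_ne_zero j m)
    (volume_dyadicCube_ne_top j m) (volume_dilatedCube_ne_zero j 0 m)
    (volume_dilatedCube_ne_top j 0 m) (measurableSet_dyadicCube j m) hsub hg
  have h2 : volume (dyadicCube j m) * volume (dilatedCube j 0 m) ^ (p - 1) *
      apQuantity p W (dyadicCube j m) (dilatedCube j 0 m) *
      weightedIntegral p W g (dyadicCube j m) ≠ ∞ := by
    refine ENNReal.mul_ne_top (ENNReal.mul_ne_top (ENNReal.mul_ne_top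
      (volume_dyadicCube_ne_top _ _) (ENNReal.rpow_ne_top_of_nonneg (by linarith)
      (volume_dilatedCube_ne_top _ _ _))) ?_) h
    exact ne_top_of_le_ne_top (ENNReal.mul_ne_top hC (two_rpow_ne_top _)) (hC' j 0 m)
  -- otherwise the inner integral would be infinite almost everywhere on a cube of positive measure
  have h3 : ∃ᵐ x ∂(volume.restrict (dyadicCube j m)), (∫⁻ y in dyadicCube j m,
      ‖Matrix.toEuclideanCLM (n := Fin d) (𝕜 := ℂ) (matPow (1 / p) (W x)) (g y)‖ₑ) ≠ ∞ := by
    intro hcon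
    refine ne_top_of_le_ne_top h2 h1 ?_
    rw [lintegral_congr_ae (g := fun _ => ∞) (by
      filter_upwards [hcon] with x hx
      rw [not_not.1 hx, ENNReal.top_rpow_of_pos (by linarith)])]
    rw [lintegral_const, Measure.restrict_apply_univ,
      ENNReal.top_mul (volume_dyadicCube_ne_zero _ _)]
  obtain ⟨x, hx, hpd⟩ := (h3.and_eventually (ae_restrict_of_ae hW.ae_posDef)).exists
  have hint : IntegrableOn (fun y =>
      Matrix.toEuclideanCLM (n := Fin d) (𝕜 := ℂ) (matPow (1 / p) (W x)) (g y))
      (dyadicCube j m) :=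
    ⟨(ContinuousLinearMap.continuous _).comp_aestronglyMeasurable hg.restrict,
      lt_top_iff_ne_top.2 hx⟩
  have := (Matrix.toEuclideanCLM (n := Fin d) (𝕜 := ℂ)
    (matPow (-(1 / p)) (W x))).integrable_comp hint
  refine this.congr (ae_of_all _ fun y => ?_)
  have hone : Matrix.toEuclideanCLM (n := Fin d) (𝕜 := ℂ) (matPow (-(1 / p)) (W x)) *
      Matrix.toEuclideanCLM (n := Fin d) (𝕜 := ℂ) (matPow (1 / p) (W x)) = 1 := by
    rw [← map_mul, matPow_neg_mul_matPow hpd, map_one]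
  exact congrArg (fun L : EuclideanSpace ℂ (Fin d) →L[ℂ] EuclideanSpace ℂ (Fin d) => L (g y)) hone

/-- The kernel of the dual weight `W^{-1/(p-1)}` is the kernel of `W` with the variables exchanged. -/
theorem crossNorm_dual (hp : 1 < p) {x y : EuclideanSpace ℝ (Fin n)} (hx : (W x).PosDef)
    (hy : (W y).PosDef) :
    crossNorm (p / (p - 1)) (fun x => matPow (-(1 / (p - 1))) (W x)) x y = crossNorm p W y x := by
  have hp1 : p - 1 ≠ 0 := by linarith
  have hp0 : p ≠ 0 := by linarith
  have hs : -(1 / (p - 1)) ≠ 0 := by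
    rw [neg_ne_zero]
    exact one_div_ne_zero hp1
  have he : -(1 / (p - 1)) * (1 / (p / (p - 1))) = -(1 / p) := by
    field_simp
  simp only [crossNorm]
  rw [matPow_matPow hx hs, matPow_matPow hy hs, mul_neg, he, neg_neg,
    opNorm_mul_comm_of_posDef (posDef_matPow hx _) (posDef_matPow hy _)]

theorem opNorm_le_crossNorm (hp : 1 ≤ p) {x y : EuclideanSpace ℝ (Fin n)} (hx : (W x).PosDef)
    (hy : (W y).PosDef) :
    ENNReal.ofReal (opNorm (W y)) ≤ crossNorm p W y x ^ p * ENNReal.ofReal (opNorm (W x)) := by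
  have hp0 : 0 < p := by linarith
  rw [← ofReal_opNorm_matPow_rpow hx hp0, ← ofReal_opNorm_matPow_rpow hy hp0,
    ← ENNReal.mul_rpow_of_nonneg _ _ hp0.le]
  refine ENNReal.rpow_le_rpow ?_ hp0.le
  rw [crossNorm, ← ENNReal.ofReal_mul (show 0 ≤ opNorm _ from norm_nonneg _)]
  refine ENNReal.ofReal_le_ofReal ?_
  refine le_trans (le_of_eq ?_) (opNorm_mul_le _ _)
  rw [mul_assoc, matPow_neg_mul_matPow hx, mul_one]

/-- Doubling estimate for `p = 1`: by the `𝒜_1` condition the mean of `‖W‖` over `R` is at most a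
multiple of `‖W(y)‖` for almost every `y ∈ R`; integrate over `y ∈ Q`. -/
theorem weightMass_le_of_one (hW : IsMatrixWeight W) {C : ℝ≥0∞}
    {Q R : Set (EuclideanSpace ℝ (Fin n))} (hQR : Q ⊆ R) (hR0 : volume R ≠ 0) (hR : volume R ≠ ∞)
    (hC : apQuantity 1 W R R ≤ C) :
    volume Q * weightMass W R ≤ volume R * C * weightMass W Q := by
  have h1 : ∀ᵐ y ∂(volume.restrict Q),
      weightMass W R ≤ volume R * C * ENNReal.ofReal (opNorm (W y)) := by
    filter_upwards [ae_restrict_of_ae_restrict_of_subset hQR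
      (ae_lintegral_crossNorm_le (W := W) (Q := R) (R := R) hR0 hR),
      ae_restrict_of_ae hW.ae_posDef] with y hy hpd
    calc weightMass W R
        ≤ ∫⁻ x in R, crossNorm 1 W x y * ENNReal.ofReal (opNorm (W y)) := by
          refine lintegral_mono_ae (ae_restrict_of_ae ?_)
          filter_upwards [hW.ae_posDef] with x hx
          simpa using opNorm_le_crossNorm le_rfl hpd hx
      _ = (∫⁻ x in R, crossNorm 1 W x y) * ENNReal.ofReal (opNorm (W y)) :=
          lintegral_mul_const' _ _ ENNReal.ofReal_ne_top
      _ ≤ _ := by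
          gcongr
          exact hy.trans (by gcongr)
  calc volume Q * weightMass W R = ∫⁻ _ in Q, weightMass W R := by
        rw [lintegral_const, Measure.restrict_apply_univ, mul_comm]
    _ ≤ ∫⁻ y in Q, volume R * C * ENNReal.ofReal (opNorm (W y)) := lintegral_mono_ae h1
    _ = _ := lintegral_const_mul'' _ hW.aemeasurable_opNorm.restrict

/-- Doubling estimate for `p > 1`: `‖W(y)‖ ≤ ‖W^{1/p}(y) W^{-1/p}(x)‖^p ‖W(x)‖` is integrated over
`y ∈ R`, and its `p`-th root over `x ∈ Q` with Hölder's inequality; the first factor becomes the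
quantity `Φ` of the dual weight. -/
theorem weightMass_le_of_one_lt (hW : IsMatrixWeight W) (hp : 1 < p) {C : ℝ≥0∞}
    {Q R : Set (EuclideanSpace ℝ (Fin n))} (hQ0 : volume Q ≠ 0) (hQ : volume Q ≠ ∞)
    (hR0 : volume R ≠ 0) (hR : volume R ≠ ∞)
    (hC : apQuantity (p / (p - 1)) (fun x => matPow (-(1 / (p - 1))) (W x)) Q R ≤ C) :
    volume Q * weightMass W R ≤ volume R * C ^ (p - 1) * weightMass W Q := by
  have hp0 : 0 < p := by linarith
  have hp1 : 0 < p - 1 := by linarith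
  set q := p / (p - 1) with hq
  have hpq : p.HolderConjugate q := Real.HolderConjugate.conjExponent hp
  have hqp : q / (q - 1) = p := hpq.symm.conjExponent_eq
  set G : EuclideanSpace ℝ (Fin n) → ℝ≥0∞ := fun x => ∫⁻ y in R, crossNorm p W y x ^ p with hG
  have hcross : AEMeasurable (fun z : EuclideanSpace ℝ (Fin n) × EuclideanSpace ℝ (Fin n) =>
      crossNorm p W z.2 z.1 ^ p) ((volume.restrict Q).prod (volume.restrict R)) := by
    rw [Measure.prod_restrict]
    exact ((hW.aemeasurable_crossNorm p).prod_swap.pow_const p).restrict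
  have hGm : AEMeasurable G (volume.restrict Q) := hcross.lintegral_prod_right'
  have hdual : ∫⁻ x in Q, G x ^ (q / p) =
      volume Q * volume R ^ (q - 1) *
        apQuantity q (fun x => matPow (-(1 / (p - 1))) (W x)) Q R := by
    rw [← lintegral_crossNorm_eq hpq.symm.lt hQ0 hQ hR0 hR, hqp]
    refine lintegral_congr_ae (ae_restrict_of_ae ?_)
    filter_upwards [hW.ae_posDef] with x hx
    refine congrArg (fun z : ℝ≥0∞ => z ^ (q / p)) ?_
    refine lintegral_congr_ae (ae_restrict_of_ae ?_)
    filter_upwards [hW.ae_posDef] with y hy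
    rw [hq, crossNorm_dual hp hx hy]
  have h1 : ∀ᵐ x ∂(volume.restrict Q),
      weightMass W R ^ (1 / p) ≤ G x ^ (1 / p) * ENNReal.ofReal (opNorm (W x)) ^ (1 / p) := by
    filter_upwards [ae_restrict_of_ae hW.ae_posDef] with x hx
    rw [← ENNReal.mul_rpow_of_nonneg _ _ (by positivity)]
    refine ENNReal.rpow_le_rpow ?_ (by positivity)
    rw [hG, ← lintegral_mul_const' _ _ ENNReal.ofReal_ne_top]
    refine lintegral_mono_ae (ae_restrict_of_ae ?_)
    filter_upwards [hW.ae_posDef] with y hy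
    exact opNorm_le_crossNorm hp.le hx hy
  have h2 : volume Q * weightMass W R ^ (1 / p) ≤
      (∫⁻ x in Q, G x ^ (q / p)) ^ (1 / q) * weightMass W Q ^ (1 / p) := by
    calc volume Q * weightMass W R ^ (1 / p) = ∫⁻ _ in Q, weightMass W R ^ (1 / p) := by
          rw [lintegral_const, Measure.restrict_apply_univ, mul_comm]
      _ ≤ ∫⁻ x in Q, G x ^ (1 / p) * ENNReal.ofReal (opNorm (W x)) ^ (1 / p) :=
          lintegral_mono_ae h1
      _ ≤ _ := ENNReal.lintegral_mul_le_Lp_mul_Lq _ hpq.symm (hGm.pow_const _)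
          (hW.aemeasurable_opNorm.restrict.pow_const _)
      _ = _ := by
          simp only [← ENNReal.rpow_mul, one_div_mul_cancel hp0.ne', ENNReal.rpow_one,
            one_div_mul_eq_div]
          rfl
  have h3 := ENNReal.rpow_le_rpow h2 hp0.le
  rw [ENNReal.mul_rpow_of_nonneg _ _ hp0.le, ENNReal.mul_rpow_of_nonneg _ _ hp0.le,
    ← ENNReal.rpow_mul, ← ENNReal.rpow_mul, ← ENNReal.rpow_mul, one_div_mul_cancel hp0.ne',
    ENNReal.rpow_one, ENNReal.rpow_one, one_div_mul_eq_div, hdual] at h3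
  have hpq1 : p / q = p - 1 := by
    rw [hq]
    field_simp
  have hpq2 : (q - 1) * (p - 1) = 1 := by
    rw [hq]
    field_simp
    ring
  rw [hpq1, ENNReal.mul_rpow_of_nonneg _ _ hp1.le, ENNReal.mul_rpow_of_nonneg _ _ hp1.le,
    ← ENNReal.rpow_mul, hpq2, ENNReal.rpow_one] at h3
  have h4 : volume Q ^ p = volume Q ^ (p - 1) * volume Q := by
    conv_rhs => rw [← ENNReal.rpow_one (volume Q), ← ENNReal.rpow_mul, one_mul,
      ← ENNReal.rpow_add _ _ hQ0 hQ]
    ring_nf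
  rw [h4, mul_assoc, mul_assoc, mul_assoc, ENNReal.mul_le_mul_iff_right
    (by rw [Ne, ENNReal.rpow_eq_zero_iff_of_pos hp1]; exact hQ0)
    (ENNReal.rpow_ne_top_of_nonneg hp1.le hQ)] at h3
  refine h3.trans ?_
  rw [mul_assoc]
  gcongr

/-- The weight grows from a dyadic cube to its ancestors at most at the rate `β̃`. -/
theorem MatrixAp.weightMass_ancestor_le (hW : MatrixAp p W) (hp : 1 ≤ p) {δ' : ℝ}
    (hδ' : 1 < p → HasApDimension (p / (p - 1)) (fun x => matPow (-(1 / (p - 1))) (W x)) δ') :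
    ∃ C : ℝ≥0∞, C ≠ ∞ ∧ C ≠ 0 ∧ ∀ (j : ℤ) (k : ℕ) (m : Fin n → ℤ),
      weightMass W (dyadicCube (j - k) (ancestor k m)) ≤
        C * 2 ^ ((k : ℝ) * betaTilde n p δ') * weightMass W (dyadicCube j m) := by
  suffices h : ∃ C : ℝ≥0∞, C ≠ ∞ ∧ ∀ (j : ℤ) (k : ℕ) (m : Fin n → ℤ),
      volume (dyadicCube j m) * weightMass W (dilatedCube j k m) ≤
        volume (dilatedCube j k m) * (C * 2 ^ ((k : ℝ) * (betaTilde n p δ' - n))) *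
          weightMass W (dyadicCube j m) by
    obtain ⟨C, hC, h⟩ := h
    refine ⟨(C + 1) * 2 ^ (n : ℝ), ENNReal.mul_ne_top (by simp [hC]) (two_rpow_ne_top _),
      mul_ne_zero (by simp) (two_rpow_ne_zero _), fun j k m => ?_⟩
    have h1 := h j k m
    rw [← ENNReal.mul_le_mul_iff_right (volume_dyadicCube_ne_zero j m)
      (volume_dyadicCube_ne_top j m)]
    calc _ ≤ volume (dyadicCube j m) * weightMass W (dilatedCube j k m) := by
          gcongr
          exact lintegral_mono_set (ancestor_subset_cube j k m)
      _ ≤ _ := h1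
      _ ≤ volume (dilatedCube j k m) * ((C + 1) * 2 ^ ((k : ℝ) * (betaTilde n p δ' - n))) *
          weightMass W (dyadicCube j m) := by
          gcongr
          exact le_self_add
      _ = _ := by
          have hc : ∀ a c e I : ℝ≥0∞, a * (c * e) * I = c * (a * e) * I := fun a c e I => by ring
          have hc' : ∀ a c e f I : ℝ≥0∞, a * (c * e * f * I) = c * (a * e * f) * I :=
            fun a c e f I => by ring
          rw [volume_dilatedCube, volume_dyadicCube_eq_two_rpow, hc, hc', two_rpow_mul,
            two_rpow_mul, two_rpow_mul]
          ring_nf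
  rcases hp.eq_or_lt with rfl | hp
  · obtain ⟨C, -, hC⟩ := hW.2
    refine ⟨ENNReal.ofReal C, ENNReal.ofReal_ne_top, fun j k m => ?_⟩
    have hsub : dyadicCube j m ⊆ dilatedCube j k m :=
      (dyadicCube_subset_ancestor j k m).trans (ancestor_subset_cube j k m)
    simpa [betaTilde] using weightMass_le_of_one hW.1 hsub (volume_dilatedCube_ne_zero j k m)
      (volume_dilatedCube_ne_top j k m) (hC _ _ (by positivity))
  · obtain ⟨C, hC, h⟩ := (hδ' hp).dyadic
    have hp1 : 0 < p - 1 := by linarith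
    refine ⟨C ^ (p - 1), ENNReal.rpow_ne_top_of_nonneg hp1.le hC, fun j k m => ?_⟩
    have h1 := weightMass_le_of_one_lt hW.1 hp (volume_dyadicCube_ne_zero j m)
      (volume_dyadicCube_ne_top j m) (volume_dilatedCube_ne_zero j k m)
      (volume_dilatedCube_ne_top j k m) (h j k m)
    rw [ENNReal.mul_rpow_of_nonneg _ _ hp1.le, ← ENNReal.rpow_mul] at h1
    have hb : betaTilde n p δ' - n = δ' * (p - 1) := by
      rw [betaTilde, if_neg hp.ne']
      field_simp
      ring
    rwa [hb, ← mul_assoc (k : ℝ)]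

end DyadicEstimates

/-! ### The norm, and domination of dyadic averages -/

section Norm
variable {n d : ℕ} {W : EuclideanSpace ℝ (Fin n) → Matrix (Fin d) (Fin d) ℂ} {p t r : ℝ}
  {f g : EuclideanSpace ℝ (Fin n) → EuclideanSpace ℂ (Fin d)}

theorem weightedIntegral_rpow_add_le (hW : IsMatrixWeight W) (hp : 1 ≤ p)
    (hf : AEStronglyMeasurable f) (hg : AEStronglyMeasurable g)
    (E : Set (EuclideanSpace ℝ (Fin n))) :
    weightedIntegral p W (f + g) E ^ (1 / p) ≤
      weightedIntegral p W f E ^ (1 / p) + weightedIntegral p W g E ^ (1 / p) := by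
  simp only [weightedIntegral_eq]
  refine le_trans ?_ (ENNReal.lintegral_Lp_add_le (hW.aemeasurable_wSize p hf).restrict
    (hW.aemeasurable_wSize p hg).restrict hp)
  have hp0 : 0 ≤ p := by linarith
  gcongr with x
  exact wSize_add_le p f g x

theorem weightedIntegral_neg (E : Set (EuclideanSpace ℝ (Fin n))) :
    weightedIntegral p W (-f) E = weightedIntegral p W f E := by
  simp only [weightedIntegral_eq, wSize_neg]

theorem weightedIntegral_smul (hp : 0 < p) (c : ℂ) (E : Set (EuclideanSpace ℝ (Fin n))) :
    weightedIntegral p W (c • f) E = ‖c‖ₑ ^ p * weightedIntegral p W f E := by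
  simp only [weightedIntegral_eq, wSize_smul, ENNReal.mul_rpow_of_nonneg _ _ hp.le]
  exact lintegral_const_mul' _ _ (ENNReal.rpow_ne_top_of_nonneg hp.le enorm_ne_top)

theorem weightedIntegral_indicator_le (hp : 0 < p) (s E : Set (EuclideanSpace ℝ (Fin n))) :
    weightedIntegral p W (s.indicator f) E ≤ weightedIntegral p W f E := by
  simp only [weightedIntegral_eq]
  gcongr with x
  exact wSize_indicator_le p s f x

theorem weightedIntegral_congr {E : Set (EuclideanSpace ℝ (Fin n))} (hE : MeasurableSet E)
    (h : Set.EqOn f g E) : weightedIntegral p W f E = weightedIntegral p W g E := by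
  simp only [weightedIntegral_eq]
  refine setLIntegral_congr_fun hE fun x hx => ?_
  simp only [wSize, h hx]

/-- The contribution of one dyadic cube to the `r`-th power of the Bourgain–Morrey norm. -/
def cubeTerm (p t r : ℝ) (W : EuclideanSpace ℝ (Fin n) → Matrix (Fin d) (Fin d) ℂ)
    (f : EuclideanSpace ℝ (Fin n) → EuclideanSpace ℂ (Fin d)) (q : ℤ × (Fin n → ℤ)) : ℝ≥0∞ :=
  (weightMass W (dyadicCube q.1 q.2) ^ (1 / t - 1 / p) *
    weightedIntegral p W f (dyadicCube q.1 q.2) ^ (1 / p)) ^ r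

theorem bmNorm_eq (p t r : ℝ) (W : EuclideanSpace ℝ (Fin n) → Matrix (Fin d) (Fin d) ℂ)
    (f : EuclideanSpace ℝ (Fin n) → EuclideanSpace ℂ (Fin d)) :
    bmNorm p t r W f = (∑' q, cubeTerm p t r W f q) ^ (1 / r) := rfl

theorem bmNorm_mono (hp : 0 < p) (hr : 0 < r) (h : ∀ j m,
    weightedIntegral p W f (dyadicCube j m) ≤ weightedIntegral p W g (dyadicCube j m)) :
    bmNorm p t r W f ≤ bmNorm p t r W g := by
  rw [bmNorm, bmNorm]
  gcongr
  exact h _ _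

theorem bmNorm_neg : bmNorm p t r W (-f) = bmNorm p t r W f := by
  simp only [bmNorm, weightedIntegral_neg]

theorem bmNorm_smul (hp : 0 < p) (hr : 0 < r) (c : ℂ) :
    bmNorm p t r W (c • f) = ‖c‖ₑ * bmNorm p t r W f := by
  have h : ∀ q, cubeTerm p t r W (c • f) q = ‖c‖ₑ ^ r * cubeTerm p t r W f q := fun q => by
    rw [cubeTerm, cubeTerm, weightedIntegral_smul hp,
      ENNReal.mul_rpow_of_nonneg (‖c‖ₑ ^ p) _ (show 0 ≤ 1 / p by positivity),
      ← ENNReal.rpow_mul, mul_one_div_cancel hp.ne', ENNReal.rpow_one, mul_left_comm,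
      ENNReal.mul_rpow_of_nonneg _ _ hr.le]
  rw [bmNorm_eq, bmNorm_eq]
  simp only [h]
  rw [ENNReal.tsum_mul_left, ENNReal.mul_rpow_of_nonneg _ _ (by positivity), ← ENNReal.rpow_mul,
    mul_one_div_cancel hr.ne', ENNReal.rpow_one]

theorem bmNorm_indicator_le (hp : 0 < p) (hr : 0 < r) (s : Set (EuclideanSpace ℝ (Fin n))) :
    bmNorm p t r W (s.indicator f) ≤ bmNorm p t r W f :=
  bmNorm_mono hp hr fun _ _ => weightedIntegral_indicator_le hp _ _

theorem bmNorm_add_le (hW : IsMatrixWeight W) (hp : 1 ≤ p) (hr : 1 ≤ r)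
    (hf : AEStronglyMeasurable f) (hg : AEStronglyMeasurable g) :
    bmNorm p t r W (f + g) ≤ bmNorm p t r W f + bmNorm p t r W g := by
  let _ : MeasurableSpace (ℤ × (Fin n → ℤ)) := ⊤
  have : MeasurableSingletonClass (ℤ × (Fin n → ℤ)) := ⟨fun _ => trivial⟩
  have hr0 : 0 ≤ r := by linarith
  have hp0 : 0 ≤ p := by linarith
  let T : (EuclideanSpace ℝ (Fin n) → EuclideanSpace ℂ (Fin d)) → ℤ × (Fin n → ℤ) → ℝ≥0∞ :=
    fun f q => weightMass W (dyadicCube q.1 q.2) ^ (1 / t - 1 / p) *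
      weightedIntegral p W f (dyadicCube q.1 q.2) ^ (1 / p)
  have hT : ∀ f, bmNorm p t r W f = (∫⁻ q, T f q ^ r ∂Measure.count) ^ (1 / r) := fun f => by
    rw [lintegral_count]
    rfl
  rw [hT, hT, hT]
  refine le_trans ?_ (ENNReal.lintegral_Lp_add_le (measurable_from_top (f := T f)).aemeasurable
    (measurable_from_top (f := T g)).aemeasurable hr)
  gcongr with q
  simp only [T, Pi.add_apply, ← mul_add]
  gcongr
  exact weightedIntegral_rpow_add_le hW hp hf hg _

theorem bmNorm_sub_le (hW : IsMatrixWeight W) (hp : 1 ≤ p) (hr : 1 ≤ r)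
    (hf : AEStronglyMeasurable f) (hg : AEStronglyMeasurable g) :
    bmNorm p t r W (f - g) ≤ bmNorm p t r W f + bmNorm p t r W g := by
  rw [sub_eq_add_neg, ← bmNorm_neg (f := g)]
  exact bmNorm_add_le hW hp hr hf hg.neg

end Norm

section Averaging
variable {n d : ℕ} {W : EuclideanSpace ℝ (Fin n) → Matrix (Fin d) (Fin d) ℂ} {p t r : ℝ}
  {f g : EuclideanSpace ℝ (Fin n) → EuclideanSpace ℂ (Fin d)}

theorem dyadicAverage_apply (a : ℤ) (f : EuclideanSpace ℝ (Fin n) → EuclideanSpace ℂ (Fin d))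
    (x : EuclideanSpace ℝ (Fin n)) :
    dyadicAverage a f x = ⨍ y in dyadicCube (-a) (dyadicIndex (-a) x), f y := by
  rw [dyadicAverage, tsum_eq_single (dyadicIndex (-a) x)]
  · exact Set.indicator_of_mem (mem_dyadicCube_iff.2 rfl) _
  · intro m hm
    exact Set.indicator_of_notMem (fun h => hm (mem_dyadicCube_iff.1 h).symm) _

theorem aestronglyMeasurable_dyadicAverage (a : ℤ)
    (f : EuclideanSpace ℝ (Fin n) → EuclideanSpace ℂ (Fin d)) :
    AEStronglyMeasurable (dyadicAverage a f) := by
  have h : dyadicAverage a f =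
      (fun m => ⨍ y in dyadicCube (-a) m, f y) ∘ dyadicIndex (-a) :=
    funext fun x => dyadicAverage_apply a f x
  rw [h]
  exact ((Measurable.of_discrete).comp (measurable_dyadicIndex _)).aestronglyMeasurable

/-- The weighted integral of a dyadic average over a cube that is `k` generations below its scale, and
over one that is `k` generations above it. -/
theorem HasApDimension.weightedIntegral_dyadicAverage_le (hW : IsMatrixWeight W) (hp : 1 ≤ p)
    {δ : ℝ} (hδ : HasApDimension p W δ) :
    ∃ C : ℝ≥0∞, C ≠ ∞ ∧ ∀ g : EuclideanSpace ℝ (Fin n) → EuclideanSpace ℂ (Fin d),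
      AEStronglyMeasurable g → ∀ (k : ℕ) (j : ℤ) (m : Fin n → ℤ),
      (weightedIntegral p W (dyadicAverage (-(j - k)) g) (dyadicCube j m) ≤
        C * 2 ^ ((k : ℝ) * (δ - n)) *
          weightedIntegral p W g (dyadicCube (j - k) (ancestor k m))) ∧
      weightedIntegral p W (dyadicAverage (-(j + k)) g) (dyadicCube j m) ≤
        C * weightedIntegral p W g (dyadicCube j m) := by
  obtain ⟨C, hC, h⟩ := hδ.lintegral_average_le hW hp
  have hsmall : ∀ g : EuclideanSpace ℝ (Fin n) → EuclideanSpace ℂ (Fin d),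
      AEStronglyMeasurable g → ∀ (k : ℕ) (j : ℤ) (m : Fin n → ℤ),
      weightedIntegral p W (dyadicAverage (-(j - k)) g) (dyadicCube j m) ≤
        C * 2 ^ ((k : ℝ) * (δ - n)) *
          weightedIntegral p W g (dyadicCube (j - k) (ancestor k m)) := by
    intro g hg k j m
    refine le_trans (le_of_eq ?_) (h j k m g hg)
    refine weightedIntegral_congr (measurableSet_dyadicCube j m) fun x hx => ?_
    rw [mem_dyadicCube_iff] at hx
    rw [dyadicAverage_apply, neg_neg, dyadicIndex_sub, hx]
  refine ⟨C, hC, fun g hg k j m => ⟨hsmall g hg k j m, ?_⟩⟩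
  rw [weightedIntegral_eq, weightedIntegral_eq, lintegral_dyadicCube_eq_tsum j k m,
    lintegral_dyadicCube_eq_tsum j k m, ← ENNReal.tsum_mul_left]
  refine ENNReal.tsum_le_tsum fun m' => ?_
  have := hsmall g hg 0 (j + k) m'.1
  have h0 : ancestor 0 m'.1 = m'.1 := by
    funext i
    simp [ancestor]
  simpa [weightedIntegral_eq, h0] using this

/-- No positivity or finiteness of `a` and `b` is needed: `0 ^ s = ∞` and `∞ ^ s = 0` for `s < 0`. -/
theorem rpow_le_mul_rpow_of_le_mul {a b K : ℝ≥0∞} {s : ℝ} (hs : s ≤ 0) (hK0 : K ≠ 0) (hK : K ≠ ∞)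
    (h : b ≤ K * a) : a ^ s ≤ K ^ (-s) * b ^ s := by
  have h1 := ENNReal.rpow_le_rpow h (neg_nonneg.2 hs)
  rw [ENNReal.mul_rpow_of_nonneg _ _ (neg_nonneg.2 hs), ENNReal.rpow_neg b,
    ENNReal.rpow_neg a] at h1
  have hK' : K ^ (-s) ≠ ∞ := ENNReal.rpow_ne_top_of_nonneg (neg_nonneg.2 hs) hK
  have hK0' : K ^ (-s) ≠ 0 := by
    rw [Ne, ENNReal.rpow_eq_zero_iff]
    simp [hK0, hK]
  have h2 := ENNReal.inv_le_inv.2 h1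
  rw [ENNReal.mul_inv (Or.inl hK0') (Or.inl hK'), inv_inv, inv_inv,
    ENNReal.inv_mul_le_iff hK0' hK'] at h2
  exact h2

/-- Domination of the terms of the norm of `E_a g` by terms of the norm of `g`, uniformly in the
scale `a`: cubes larger than the scale `2^a` are compared with themselves, smaller cubes with
their ancestors, with a geometric loss that the condition on the exponents makes summable. -/
theorem MatrixAp.cubeTerm_dyadicAverage_le (hW : MatrixAp p W) (hp : 1 ≤ p) (hpt : p < t)
    (htr : t < r) {δ δ' : ℝ} (hδ : HasApDimension p W δ)
    (hδ' : 1 < p → HasApDimension (p / (p - 1)) (fun x => matPow (-(1 / (p - 1))) (W x)) δ')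
    (hcond : -((n : ℝ) * r / p) + δ * r / p + n
      - betaTilde n p δ' * r * (1 / t - 1 / p) < 0) :
    ∃ c : ℕ → ℝ≥0∞, ∑' k, c k * 2 ^ (k * n) ≠ ∞ ∧
      ∀ (a : ℤ) (g : EuclideanSpace ℝ (Fin n) → EuclideanSpace ℂ (Fin d)),
      AEStronglyMeasurable g → ∀ q, cubeTerm p t r W (dyadicAverage a g) q ≤
        ∑' k, c k * cubeTerm p t r W g (q.1 - k, ancestor k q.2) := by
  obtain ⟨C, hC, hav⟩ := hδ.weightedIntegral_dyadicAverage_le hW.1 hp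
  obtain ⟨D, hD, hD0, hdb⟩ := hW.weightMass_ancestor_le hp hδ'
  have hp0 : 0 < p := by linarith
  have hr0 : 0 < r := by linarith
  set σ : ℝ := 1 / t - 1 / p with hσ
  have hσ0 : σ ≤ 0 := sub_nonpos.2 (one_div_le_one_div_of_le hp0 hpt.le)
  set β := betaTilde n p δ' with hβ
  set γ : ℝ := -((n : ℝ) * r / p) + δ * r / p + n - β * r * σ with hγ
  -- the summand `1` covers cubes above the scale of the average, the other one cubes below it
  set K : ℝ≥0∞ := C ^ (r / p) * (1 + D ^ (-σ * r)) with hK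
  have hσr : 0 ≤ -σ * r := mul_nonneg (neg_nonneg.2 hσ0) hr0.le
  have hKtop : K ≠ ∞ := ENNReal.mul_ne_top (ENNReal.rpow_ne_top_of_nonneg (by positivity) hC)
    (ENNReal.add_ne_top.2 ⟨ENNReal.one_ne_top, ENNReal.rpow_ne_top_of_nonneg hσr hD⟩)
  refine ⟨fun k => K * 2 ^ ((k : ℝ) * (γ - n)), ?_, fun a g hg q => ?_⟩
  · have h1 : ∀ k : ℕ, K * 2 ^ ((k : ℝ) * (γ - n)) * 2 ^ (k * n) = K * ((2 : ℝ≥0∞) ^ γ) ^ k := by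
      intro k
      rw [mul_assoc, ← ENNReal.rpow_natCast, two_rpow_mul, ← ENNReal.rpow_natCast,
        ← ENNReal.rpow_mul]
      push_cast
      ring_nf
    simp_rw [h1]
    rw [ENNReal.tsum_mul_left, ENNReal.tsum_geometric]
    refine ENNReal.mul_ne_top hKtop (ENNReal.inv_ne_top.2 (tsub_pos_of_lt ?_).ne')
    exact ENNReal.rpow_lt_one_of_one_lt_of_neg (by norm_num) hcond
  · obtain ⟨j, m⟩ := q
    rcases le_total (-a) j with hja | hja
    · obtain ⟨k, hk⟩ := Int.le.dest hja
      obtain rfl : a = -(j - k) := by omega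
      refine le_trans ?_ (ENNReal.le_tsum k)
      have h1 := (hav g hg k j m).1
      have h2 := rpow_le_mul_rpow_of_le_mul hσ0 (mul_ne_zero hD0 (two_rpow_ne_zero _))
        (ENNReal.mul_ne_top hD (two_rpow_ne_top _)) (hdb j k m)
      set w := weightMass W (dyadicCube (j - k) (ancestor k m)) ^ σ with hw
      set I := weightedIntegral p W g (dyadicCube (j - k) (ancestor k m)) with hI
      have hrp : 0 ≤ 1 / p := by positivity
      have hs : 0 ≤ -σ := neg_nonneg.2 hσ0
      calc cubeTerm p t r W (dyadicAverage (-(j - k)) g) (j, m)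
          ≤ ((D * 2 ^ ((k : ℝ) * β)) ^ (-σ) * w *
              (C * 2 ^ ((k : ℝ) * (δ - n)) * I) ^ (1 / p)) ^ r := by
            rw [cubeTerm]
            gcongr
        _ = (C ^ (r / p) * D ^ (-σ * r)) * 2 ^ ((k : ℝ) * (γ - n)) * (w * I ^ (1 / p)) ^ r := by
            rw [ENNReal.mul_rpow_of_nonneg _ _ hs, ENNReal.mul_rpow_of_nonneg _ _ hrp,
              ENNReal.mul_rpow_of_nonneg _ _ hrp, ENNReal.mul_rpow_of_nonneg _ _ hr0.le,
              ENNReal.mul_rpow_of_nonneg _ _ hr0.le, ENNReal.mul_rpow_of_nonneg _ _ hr0.le,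
              ENNReal.mul_rpow_of_nonneg _ _ hr0.le, ENNReal.mul_rpow_of_nonneg _ _ hr0.le,
              ENNReal.mul_rpow_of_nonneg _ _ hr0.le]
            simp only [← ENNReal.rpow_mul]
            have hc : ∀ a b c e f h : ℝ≥0∞, a * b * c * (e * f * h) = e * a * (b * f) * (c * h) :=
              fun a b c e f h => by ring
            rw [hc, two_rpow_mul, one_div_mul_eq_div]
            congr 3
            rw [hγ]
            ring
        _ ≤ K * 2 ^ ((k : ℝ) * (γ - n)) * cubeTerm p t r W g (j - k, ancestor k m) := by
            rw [cubeTerm, hK]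
            gcongr
            exact le_add_self
    · obtain ⟨k, hk⟩ := Int.le.dest hja
      obtain rfl : a = -(j + k) := by omega
      refine le_trans ?_ (ENNReal.le_tsum 0)
      have h1 := (hav g hg k j m).2
      have h0 : ancestor 0 m = m := by
        funext i
        simp [ancestor]
      simp only [Nat.cast_zero, zero_mul, ENNReal.rpow_zero, mul_one, sub_zero, h0]
      calc cubeTerm p t r W (dyadicAverage (-(j + k)) g) (j, m)
          ≤ (weightMass W (dyadicCube j m) ^ σ *
              (C * weightedIntegral p W g (dyadicCube j m)) ^ (1 / p)) ^ r := by
            rw [cubeTerm]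
            gcongr
        _ = C ^ (r / p) * cubeTerm p t r W g (j, m) := by
            rw [cubeTerm, ENNReal.mul_rpow_of_nonneg C _ (show 0 ≤ 1 / p by positivity),
              mul_left_comm,
              ENNReal.mul_rpow_of_nonneg _ _ hr0.le, ← ENNReal.rpow_mul, one_div_mul_eq_div]
        _ ≤ K * cubeTerm p t r W g (j, m) := by
            gcongr
            exact le_mul_of_one_le_right' le_self_add

/-- Summing the dominating series over all cubes counts each cube once for each of its `2^{kn}`
descendants in generation `k`. -/
theorem tsum_tsum_ancestor (c : ℕ → ℝ≥0∞) (T : ℤ × (Fin n → ℤ) → ℝ≥0∞) :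
    ∑' q : ℤ × (Fin n → ℤ), ∑' k : ℕ, c k * T (q.1 - k, ancestor k q.2) =
      (∑' k, c k * 2 ^ (k * n)) * ∑' q, T q := by
  rw [ENNReal.tsum_comm, ← ENNReal.tsum_mul_right]
  refine tsum_congr fun k => ?_
  rw [ENNReal.tsum_mul_left, tsum_ancestor_level, mul_assoc]

end Averaging

/-! ### Convergence of dyadic averages on a single cube -/

section LocalConvergence
variable {n d : ℕ} {W : EuclideanSpace ℝ (Fin n) → Matrix (Fin d) (Fin d) ℂ} {p t r : ℝ}
  {f g : EuclideanSpace ℝ (Fin n) → EuclideanSpace ℂ (Fin d)}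

theorem IsMatrixWeight.weightMass_dyadicCube_ne_top (hW : IsMatrixWeight W) (j : ℤ)
    (m : Fin n → ℤ) : weightMass W (dyadicCube j m) ≠ ∞ := by
  have hb := isBounded_dyadicCube j m
  exact ne_top_of_le_ne_top (hW.weightMass_lt_top hb.isCompact_closure).ne
    (lintegral_mono_set subset_closure)

/-- The measure `‖W(x)‖ dx` on `E`. -/
def normMeasure (W : EuclideanSpace ℝ (Fin n) → Matrix (Fin d) (Fin d) ℂ)
    (E : Set (EuclideanSpace ℝ (Fin n))) : Measure (EuclideanSpace ℝ (Fin n)) :=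
  (volume.restrict E).withDensity fun x => ENNReal.ofReal (opNorm (W x))

theorem normMeasure_absolutelyContinuous (W : EuclideanSpace ℝ (Fin n) → Matrix (Fin d) (Fin d) ℂ)
    (E : Set (EuclideanSpace ℝ (Fin n))) : normMeasure W E ≪ volume :=
  (withDensity_absolutelyContinuous _ _).trans Measure.restrict_le_self.absolutelyContinuous

theorem isFiniteMeasure_normMeasure {E : Set (EuclideanSpace ℝ (Fin n))}
    (hE : weightMass W E ≠ ∞) : IsFiniteMeasure (normMeasure W E) :=
  isFiniteMeasure_withDensity hE

theorem weightedIntegral_le_lintegral_normMeasure (hW : IsMatrixWeight W) (hp : 0 < p)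
    (hf : AEStronglyMeasurable f) (E : Set (EuclideanSpace ℝ (Fin n))) :
    weightedIntegral p W f E ≤ ∫⁻ x, ‖f x‖ₑ ^ p ∂(normMeasure W E) := by
  have h1 : AEMeasurable (fun x => ‖f x‖ₑ ^ p) (normMeasure W E) :=
    (hf.mono_ac (normMeasure_absolutelyContinuous W E)).enorm.pow_const p
  rw [normMeasure, lintegral_withDensity_eq_lintegral_mul₀' hW.aemeasurable_opNorm.restrict h1,
    weightedIntegral_eq]
  refine lintegral_mono_ae (ae_restrict_of_ae ?_)
  filter_upwards [hW.ae_posDef] with x hx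
  exact wSize_rpow_le hp hx f

/-- Density of bounded continuous functions in `L^p(W)` on `E`: truncate `g`, and approximate the
truncation in `L^p` of the finite measure `‖W‖ dx`, which dominates the weighted norm. -/
theorem exists_boundedContinuous_weightedIntegral_sub_le (hW : IsMatrixWeight W) (hp : 1 ≤ p)
    {E : Set (EuclideanSpace ℝ (Fin n))} (hE : weightMass W E ≠ ∞) (hg : AEStronglyMeasurable g)
    (hgE : weightedIntegral p W g E ≠ ∞) {ε : ℝ≥0∞} (hε : ε ≠ 0) :
    ∃ h : EuclideanSpace ℝ (Fin n) →ᵇ EuclideanSpace ℂ (Fin d),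
      weightedIntegral p W (g - h) E ^ (1 / p) ≤ ε := by
  have hp0 : 0 < p := by linarith
  let s : ℕ → Set (EuclideanSpace ℝ (Fin n)) := fun N => {x | ‖g x‖ ≤ N}
  have hs : ∀ N, NullMeasurableSet (s N) := fun N =>
    nullMeasurableSet_le hg.norm.aemeasurable aemeasurable_const
  have htr : Tendsto (fun N => weightedIntegral p W (g - (s N).indicator g) E ^ (1 / p)) atTop
      (𝓝 0) := by
    have h0 : Tendsto (fun N => weightedIntegral p W (g - (s N).indicator g) E) atTop (𝓝 0) := by
      simp only [weightedIntegral_eq] at hgE ⊢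
      have hz : ∫⁻ _ in E, (0 : ℝ≥0∞) = 0 := lintegral_zero
      rw [← hz]
      refine tendsto_lintegral_of_dominated_convergence' (fun x => wSize p W g x ^ p)
        (fun N => ((hW.aemeasurable_wSize p (hg.sub (hg.indicator₀ (hs N)))).pow_const p).restrict)
        (fun N => ae_of_all _ fun x => ?_) hgE (ae_of_all _ fun x => ?_)
      · refine ENNReal.rpow_le_rpow ?_ hp0.le
        by_cases hx : x ∈ s N <;> simp [wSize, hx]
      · refine tendsto_const_nhds.congr' ?_
        filter_upwards [eventually_ge_atTop ⌈‖g x‖⌉₊] with N hN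
        have hx : x ∈ s N := (Nat.le_ceil ‖g x‖).trans (Nat.cast_le.2 hN)
        simp [wSize, hx, hp0]
    have := h0.ennrpow_const (1 / p)
    rwa [ENNReal.zero_rpow_of_pos (by positivity)] at this
  have hε2 : ε / 2 ≠ 0 := (ENNReal.half_pos hε).ne'
  obtain ⟨N, hN⟩ := (ENNReal.tendsto_nhds_zero.1 htr (ε / 2) (pos_iff_ne_zero.2 hε2)).exists
  have := isFiniteMeasure_normMeasure hE
  have hgN : AEStronglyMeasurable ((s N).indicator g) := hg.indicator₀ (hs N)
  have hmem : MemLp ((s N).indicator g) (ENNReal.ofReal p) (normMeasure W E) := by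
    refine MemLp.of_bound (hgN.mono_ac (normMeasure_absolutelyContinuous W E)) N
      (ae_of_all _ fun x => ?_)
    by_cases hx : x ∈ s N
    · rw [Set.indicator_of_mem hx]
      exact hx
    · simp [hx]
  obtain ⟨h, hh, -⟩ := hmem.exists_boundedContinuous_eLpNorm_sub_le ENNReal.ofReal_ne_top hε2
  refine ⟨h, ?_⟩
  have hhm : AEStronglyMeasurable (h : EuclideanSpace ℝ (Fin n) → EuclideanSpace ℂ (Fin d)) :=
    h.continuous.aestronglyMeasurable
  have h2 : weightedIntegral p W ((s N).indicator g - h) E ^ (1 / p) ≤ ε / 2 := by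
    refine le_trans ?_ hh
    rw [eLpNorm_eq_lintegral_rpow_enorm_toReal (by simpa using hp0) ENNReal.ofReal_ne_top,
      ENNReal.toReal_ofReal hp0.le]
    gcongr
    exact weightedIntegral_le_lintegral_normMeasure hW hp0 (hgN.sub hhm) E
  calc weightedIntegral p W (g - h) E ^ (1 / p)
      = weightedIntegral p W ((g - (s N).indicator g) + ((s N).indicator g - h)) E ^ (1 / p) := by
        rw [sub_add_sub_cancel]
    _ ≤ ε / 2 + ε / 2 := (weightedIntegral_rpow_add_le hW hp (hg.sub hgN) (hgN.sub hhm) E).trans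
        (add_le_add hN h2)
    _ = ε := ENNReal.add_halves ε

theorem tendsto_two_zpow_atBot : Tendsto (fun a : ℤ => (2 : ℝ) ^ a) atBot (𝓝 0) := by
  have h := (tendsto_rpow_atBot_of_base_gt_one 2 one_lt_two).comp
    (tendsto_intCast_atBot_iff (R := ℝ).2 tendsto_id)
  refine h.congr fun a => ?_
  simp

theorem exists_dist_le_of_mem_dyadicCube (n : ℕ) : ∃ K : ℝ, ∀ (a : ℤ) (m : Fin n → ℤ),
    ∀ x ∈ dyadicCube (-a) m, ∀ y ∈ dyadicCube (-a) m, dist x y ≤ K * 2 ^ a := by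
  obtain ⟨K, hK⟩ : ∃ K, AntilipschitzWith K (@WithLp.ofLp 2 (Fin n → ℝ)) :=
    ⟨_, PiLp.antilipschitzWith_ofLp 2 (fun _ : Fin n => ℝ)⟩
  refine ⟨K, fun a m x hx y hy => (hK.le_mul_dist x y).trans ?_⟩
  refine mul_le_mul_of_nonneg_left ?_ NNReal.zero_le_coe
  refine (dist_pi_le_iff (by positivity)).2 fun i => ?_
  have h1 := hx i
  have h2 := hy i
  rw [neg_neg] at h1 h2
  rw [Real.dist_eq, abs_le]
  constructor <;> linarith

theorem isFiniteMeasure_restrict_dyadicCube (j : ℤ) (m : Fin n → ℤ) :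
    IsFiniteMeasure (volume.restrict (dyadicCube j m)) :=
  ⟨by
    rw [Measure.restrict_apply_univ]
    exact (volume_dyadicCube_ne_top j m).lt_top⟩

theorem integrableOn_dyadicCube_boundedContinuous
    (h : EuclideanSpace ℝ (Fin n) →ᵇ EuclideanSpace ℂ (Fin d)) (j : ℤ) (m : Fin n → ℤ) :
    IntegrableOn h (dyadicCube j m) :=
  have := isFiniteMeasure_restrict_dyadicCube j m
  BoundedContinuousFunction.integrable _ h

theorem dyadicAverage_mem_of_forall_mem {h : EuclideanSpace ℝ (Fin n) → EuclideanSpace ℂ (Fin d)}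
    (hint : ∀ j m, IntegrableOn h (dyadicCube j m)) (a : ℤ) (x : EuclideanSpace ℝ (Fin n))
    {s : Set (EuclideanSpace ℂ (Fin d))} (hs : Convex ℝ s) (hsc : IsClosed s)
    (hh : ∀ y ∈ dyadicCube (-a) (dyadicIndex (-a) x), h y ∈ s) : dyadicAverage a h x ∈ s := by
  rw [dyadicAverage_apply]
  refine hs.set_average_mem hsc (volume_dyadicCube_ne_zero _ _) (volume_dyadicCube_ne_top _ _)
    ?_ (hint _ _)
  exact (ae_restrict_iff' (measurableSet_dyadicCube _ _)).2 (ae_of_all _ hh)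

theorem tendsto_dyadicAverage (h : EuclideanSpace ℝ (Fin n) →ᵇ EuclideanSpace ℂ (Fin d))
    (x : EuclideanSpace ℝ (Fin n)) :
    Tendsto (fun a : ℤ => dyadicAverage a h x) atBot (𝓝 (h x)) := by
  obtain ⟨K, hK⟩ := exists_dist_le_of_mem_dyadicCube n
  rw [Metric.tendsto_nhds]
  intro ε hε
  obtain ⟨η, hη, hηε⟩ := Metric.continuousAt_iff.1 h.continuous.continuousAt (ε / 2) (half_pos hε)
  have hK0 : Tendsto (fun a : ℤ => K * (2 : ℝ) ^ a) atBot (𝓝 0) := by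
    simpa using tendsto_two_zpow_atBot.const_mul K
  filter_upwards [hK0.eventually (gt_mem_nhds hη)] with a ha
  have := dyadicAverage_mem_of_forall_mem (integrableOn_dyadicCube_boundedContinuous h) a x
    (convex_closedBall (h x) (ε / 2)) Metric.isClosed_closedBall fun y hy =>
      (hηε ((hK a _ y hy x (mem_dyadicCube_iff.2 rfl)).trans_lt ha)).le
  exact (Metric.mem_closedBall.1 this).trans_lt (half_lt_self hε)

theorem tendsto_weightedIntegral_sub_dyadicAverage_boundedContinuous (hW : IsMatrixWeight W)
    (hp : 1 ≤ p) {E : Set (EuclideanSpace ℝ (Fin n))} (hE : weightMass W E ≠ ∞)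
    (h : EuclideanSpace ℝ (Fin n) →ᵇ EuclideanSpace ℂ (Fin d)) :
    Tendsto (fun a : ℤ => weightedIntegral p W (h - dyadicAverage a h) E) atBot (𝓝 0) := by
  have hp0 : 0 < p := by linarith
  have := isFiniteMeasure_normMeasure hE
  have hm : ∀ a, Measurable fun x => ‖(h - dyadicAverage a h) x‖ₑ ^ p := by
    intro a
    have h1 : dyadicAverage a h = (fun m => ⨍ y in dyadicCube (-a) m, h y) ∘ dyadicIndex (-a) :=
      funext fun x => dyadicAverage_apply a h x
    have h2 : Measurable (dyadicAverage a h) := by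
      rw [h1]
      exact (Measurable.of_discrete).comp (measurable_dyadicIndex _)
    exact (h.continuous.measurable.sub h2).enorm.pow_const p
  refine tendsto_of_tendsto_of_tendsto_of_le_of_le tendsto_const_nhds ?_ (fun a => zero_le)
    (fun a => weightedIntegral_le_lintegral_normMeasure hW hp0
      (h.continuous.aestronglyMeasurable.sub (aestronglyMeasurable_dyadicAverage a h)) E)
  have hz : ∫⁻ _, (0 : ℝ≥0∞) ∂(normMeasure W E) = 0 := lintegral_zero
  rw [← hz]
  refine tendsto_lintegral_filter_of_dominated_convergence
    (fun _ => ENNReal.ofReal (‖h‖ + ‖h‖) ^ p) (Eventually.of_forall hm)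
    (Eventually.of_forall fun a => ae_of_all _ fun x => ?_) ?_ (ae_of_all _ fun x => ?_)
  · refine ENNReal.rpow_le_rpow ?_ hp0.le
    rw [← ofReal_norm]
    refine ENNReal.ofReal_le_ofReal ((norm_sub_le _ _).trans (add_le_add (h.norm_coe_le_norm x) ?_))
    have := dyadicAverage_mem_of_forall_mem (integrableOn_dyadicCube_boundedContinuous h) a x
      (convex_closedBall 0 ‖h‖) Metric.isClosed_closedBall fun y _ => by
        simpa using h.norm_coe_le_norm y
    simpa using this
  · rw [lintegral_const]
    exact ENNReal.mul_ne_top (ENNReal.rpow_ne_top_of_nonneg hp0.le ENNReal.ofReal_ne_top)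
      (measure_ne_top _ _)
  · have h1 : Tendsto (fun a : ℤ => (h - dyadicAverage a h) x) atBot (𝓝 0) := by
      simpa using (tendsto_dyadicAverage h x).const_sub (h x)
    have h2 := (h1.enorm).ennrpow_const p
    rwa [enorm_zero, ENNReal.zero_rpow_of_pos hp0] at h2

theorem dyadicAverage_sub (hf : ∀ j m, IntegrableOn f (dyadicCube j m))
    (hg : ∀ j m, IntegrableOn g (dyadicCube j m)) (a : ℤ) :
    dyadicAverage a (f - g) = dyadicAverage a f - dyadicAverage a g := by
  funext x
  simp only [Pi.sub_apply, dyadicAverage_apply, setAverage_eq]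
  rw [integral_sub (hf _ _) (hg _ _), smul_sub]

/-- On a fixed cube the dyadic averages converge in `L^p(W)`: they are uniformly bounded there once the
scale is below the size of the cube, and they converge on a dense set. -/
theorem tendsto_weightedIntegral_sub_dyadicAverage (hW : IsMatrixWeight W) (hp : 1 ≤ p) {δ : ℝ}
    (hδ : HasApDimension p W δ) (hg : AEStronglyMeasurable g)
    (hgI : ∀ j m, weightedIntegral p W g (dyadicCube j m) ≠ ∞) (j : ℤ) (m : Fin n → ℤ) :
    Tendsto (fun a : ℤ => weightedIntegral p W (g - dyadicAverage a g) (dyadicCube j m)) atBot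
      (𝓝 0) := by
  have hp0 : 0 < p := by linarith
  obtain ⟨C, hC, hav⟩ := hδ.weightedIntegral_dyadicAverage_le hW hp
  set N : (EuclideanSpace ℝ (Fin n) → EuclideanSpace ℂ (Fin d)) → ℝ≥0∞ :=
    fun f => weightedIntegral p W f (dyadicCube j m) ^ (1 / p) with hN
  have hp1 : 0 ≤ 1 / p := by positivity
  have hgint : ∀ j m, IntegrableOn g (dyadicCube j m) := fun j m =>
    hδ.integrableOn hW hp hg (hgI j m)
  suffices h : Tendsto (fun a : ℤ => N (g - dyadicAverage a g)) atBot (𝓝 0) by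
    have h2 := h.ennrpow_const p
    rw [ENNReal.zero_rpow_of_pos hp0] at h2
    refine h2.congr fun a => ?_
    rw [hN, ← ENNReal.rpow_mul, one_div_mul_cancel hp0.ne', ENNReal.rpow_one]
  rw [ENNReal.tendsto_nhds_zero]
  intro ε hε
  -- three error terms: `g - h`, `h - E_a h` and `E_a (h - g)`
  have hCp : C ^ (1 / p) + 1 + 1 ≠ ∞ :=
    ENNReal.add_ne_top.2 ⟨ENNReal.add_ne_top.2 ⟨ENNReal.rpow_ne_top_of_nonneg hp1 hC,
      ENNReal.one_ne_top⟩, ENNReal.one_ne_top⟩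
  have hη : ε / (C ^ (1 / p) + 1 + 1) ≠ 0 := (ENNReal.div_pos hε.ne' hCp).ne'
  obtain ⟨h, hh⟩ := exists_boundedContinuous_weightedIntegral_sub_le hW hp
    (hW.weightMass_dyadicCube_ne_top j m) hg (hgI j m) hη
  have hhm : AEStronglyMeasurable (h : EuclideanSpace ℝ (Fin n) → EuclideanSpace ℂ (Fin d)) :=
    h.continuous.aestronglyMeasurable
  have h1 := (tendsto_weightedIntegral_sub_dyadicAverage_boundedContinuous hW hp
    (hW.weightMass_dyadicCube_ne_top j m) h).ennrpow_const (1 / p)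
  rw [ENNReal.zero_rpow_of_pos (by positivity)] at h1
  filter_upwards [ENNReal.tendsto_nhds_zero.1 h1 _ (pos_iff_ne_zero.2 hη), eventually_le_atBot (-j)]
    with a ha haj
  obtain ⟨k, hk⟩ := Int.le.dest (show j ≤ -a by omega)
  have hE : N (dyadicAverage a (⇑h - g)) ≤ C ^ (1 / p) * N (g - ⇑h) := by
    have h2 := (hav (⇑h - g) (hhm.sub hg) k j m).2
    rw [show -(j + (k : ℤ)) = a by omega, ← neg_sub g, weightedIntegral_neg] at h2
    rw [hN, ← ENNReal.mul_rpow_of_nonneg _ _ hp1, ← neg_sub g]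
    exact ENNReal.rpow_le_rpow h2 hp1
  have hdec : g - dyadicAverage a g =
      (g - ⇑h) + ((⇑h - dyadicAverage a h) + dyadicAverage a (⇑h - g)) := by
    rw [dyadicAverage_sub (integrableOn_dyadicCube_boundedContinuous h) hgint]
    abel
  have hadd : ∀ f₁ f₂, AEStronglyMeasurable f₁ → AEStronglyMeasurable f₂ →
      N (f₁ + f₂) ≤ N f₁ + N f₂ := fun f₁ f₂ h₁ h₂ => weightedIntegral_rpow_add_le hW hp h₁ h₂ _
  have hm1 := hhm.sub (aestronglyMeasurable_dyadicAverage a h)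
  have hm2 := aestronglyMeasurable_dyadicAverage a (⇑h - g)
  calc N (g - dyadicAverage a g)
      ≤ N (g - ⇑h) + (N (⇑h - dyadicAverage a h) + N (dyadicAverage a (⇑h - g))) := by
        rw [hdec]
        refine (hadd _ _ (hg.sub hhm) (hm1.add hm2)).trans ?_
        gcongr
        exact hadd _ _ hm1 hm2
    _ ≤ ε / (C ^ (1 / p) + 1 + 1) + (ε / (C ^ (1 / p) + 1 + 1) +
          C ^ (1 / p) * (ε / (C ^ (1 / p) + 1 + 1))) := by
        gcongr
        exact hE.trans (by gcongr)
    _ = (C ^ (1 / p) + 1 + 1) * (ε / (C ^ (1 / p) + 1 + 1)) := by ring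
    _ = ε := ENNReal.mul_div_cancel (by simp) hCp

end LocalConvergence

/-! ### The Bourgain–Morrey space and finite nets -/

section Space
variable {n d : ℕ} {W : EuclideanSpace ℝ (Fin n) → Matrix (Fin d) (Fin d) ℂ} {p t r : ℝ}
  {f g : EuclideanSpace ℝ (Fin n) → EuclideanSpace ℂ (Fin d)}

/-- Dominated convergence for the sum over dyadic cubes. -/
theorem tendsto_bmNorm_zero {ι : Type*} {l : Filter ι} [l.IsCountablyGenerated] (hr : 0 < r)
    {G : ι → EuclideanSpace ℝ (Fin n) → EuclideanSpace ℂ (Fin d)}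
    {b : ℤ × (Fin n → ℤ) → ℝ≥0∞} (hb : ∑' q, b q ≠ ∞)
    (hG : ∀ i q, cubeTerm p t r W (G i) q ≤ b q)
    (hlim : ∀ q, Tendsto (fun i => cubeTerm p t r W (G i) q) l (𝓝 0)) :
    Tendsto (fun i => bmNorm p t r W (G i)) l (𝓝 0) := by
  let _ : MeasurableSpace (ℤ × (Fin n → ℤ)) := ⊤
  have : MeasurableSingletonClass (ℤ × (Fin n → ℤ)) := ⟨fun _ => trivial⟩
  have h : Tendsto (fun i => ∑' q, cubeTerm p t r W (G i) q) l (𝓝 0) := by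
    simp_rw [← lintegral_count] at hb ⊢
    have hz : ∫⁻ _, (0 : ℝ≥0∞) ∂(Measure.count : Measure (ℤ × (Fin n → ℤ))) = 0 := lintegral_zero
    rw [← hz]
    exact tendsto_lintegral_filter_of_dominated_convergence b
      (Eventually.of_forall fun i => measurable_from_top)
      (Eventually.of_forall fun i => ae_of_all _ (hG i)) hb (ae_of_all _ hlim)
  have h2 := h.ennrpow_const (1 / r)
  rwa [ENNReal.zero_rpow_of_pos (by positivity)] at h2

theorem tendsto_cubeTerm_zero (hW : IsMatrixWeight W) (hd : 0 < d) (hp : 0 < p) (hr : 0 < r)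
    {ι : Type*} {l : Filter ι} {G : ι → EuclideanSpace ℝ (Fin n) → EuclideanSpace ℂ (Fin d)}
    (q : ℤ × (Fin n → ℤ))
    (h : Tendsto (fun i => weightedIntegral p W (G i) (dyadicCube q.1 q.2)) l (𝓝 0)) :
    Tendsto (fun i => cubeTerm p t r W (G i) q) l (𝓝 0) := by
  have h1 := h.ennrpow_const (1 / p)
  rw [ENNReal.zero_rpow_of_pos (by positivity)] at h1
  have hw : weightMass W (dyadicCube q.1 q.2) ^ (1 / t - 1 / p) ≠ ∞ :=
    ENNReal.rpow_ne_top_of_ne_zero (hW.weightMass_ne_zero hd (volume_dyadicCube_ne_zero _ _))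
      (hW.weightMass_dyadicCube_ne_top _ _)
  have h2 := (ENNReal.Tendsto.const_mul h1 (Or.inr hw)).ennrpow_const r
  rwa [mul_zero, ENNReal.zero_rpow_of_pos hr] at h2

theorem tsum_cubeTerm_ne_top (hr : 0 < r) (h : bmNorm p t r W f < ∞) :
    ∑' q, cubeTerm p t r W f q ≠ ∞ := by
  rw [bmNorm_eq] at h
  intro hcon
  rw [hcon, ENNReal.top_rpow_of_pos (by positivity)] at h
  exact lt_irrefl _ h

theorem MemBM.weightedIntegral_dyadicCube_ne_top (hf : MemBM p t r W f) (j : ℤ) (m : Fin n → ℤ) :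
    weightedIntegral p W f (dyadicCube j m) ≠ ∞ := by
  have hb := isBounded_dyadicCube j m
  exact ne_top_of_le_ne_top (hf.locallyFinite _ hb.isCompact_closure).ne
    (lintegral_mono_set subset_closure)

theorem MemBM.integrableOn (hW : IsMatrixWeight W) (hp : 1 ≤ p) {δ : ℝ}
    (hδ : HasApDimension p W δ) (hf : MemBM p t r W f) (j : ℤ) (m : Fin n → ℤ) :
    IntegrableOn f (dyadicCube j m) :=
  hδ.integrableOn hW hp hf.aestronglyMeasurable (hf.weightedIntegral_dyadicCube_ne_top j m)

theorem MemBM.add (hW : IsMatrixWeight W) (hp : 1 ≤ p) (hr : 1 ≤ r) (hf : MemBM p t r W f)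
    (hg : MemBM p t r W g) : MemBM p t r W (f + g) where
  aestronglyMeasurable := hf.aestronglyMeasurable.add hg.aestronglyMeasurable
  locallyFinite K hK := by
    have hp0 : 0 < 1 / p := by positivity
    have h := weightedIntegral_rpow_add_le hW hp hf.aestronglyMeasurable hg.aestronglyMeasurable K
    rw [← ENNReal.rpow_lt_top_iff_of_pos hp0]
    refine h.trans_lt (ENNReal.add_lt_top.2 ⟨?_, ?_⟩)
    · exact (ENNReal.rpow_lt_top_iff_of_pos hp0).2 (hf.locallyFinite K hK)
    · exact (ENNReal.rpow_lt_top_iff_of_pos hp0).2 (hg.locallyFinite K hK)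
  norm_lt_top := (bmNorm_add_le hW hp hr hf.aestronglyMeasurable hg.aestronglyMeasurable).trans_lt
    (ENNReal.add_lt_top.2 ⟨hf.norm_lt_top, hg.norm_lt_top⟩)

theorem MemBM.smul (hp : 0 < p) (hr : 0 < r) (c : ℂ) (hf : MemBM p t r W f) :
    MemBM p t r W (c • f) where
  aestronglyMeasurable := hf.aestronglyMeasurable.const_smul c
  locallyFinite K hK := by
    rw [weightedIntegral_smul hp]
    exact ENNReal.mul_lt_top (ENNReal.rpow_lt_top_of_nonneg hp.le enorm_ne_top)
      (hf.locallyFinite K hK)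
  norm_lt_top := by
    rw [bmNorm_smul hp hr]
    exact ENNReal.mul_lt_top enorm_lt_top hf.norm_lt_top

theorem MemBM.sub (hW : IsMatrixWeight W) (hp : 1 ≤ p) (hr : 1 ≤ r) (hf : MemBM p t r W f)
    (hg : MemBM p t r W g) : MemBM p t r W (f - g) := by
  have := hf.add hW hp hr (hg.smul (by linarith) (by linarith) (-1))
  rwa [neg_one_smul, ← sub_eq_add_neg] at this

theorem MemBM.indicator (hp : 0 < p) (hr : 0 < r) (hf : MemBM p t r W f)
    {s : Set (EuclideanSpace ℝ (Fin n))} (hs : MeasurableSet s) :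
    MemBM p t r W (s.indicator f) where
  aestronglyMeasurable := hf.aestronglyMeasurable.indicator hs
  locallyFinite K hK :=
    (weightedIntegral_indicator_le hp s K).trans_lt (hf.locallyFinite K hK)
  norm_lt_top := (bmNorm_indicator_le hp hr s).trans_lt hf.norm_lt_top

theorem finite_image_dyadicIndex (j : ℤ) {s : Set (EuclideanSpace ℝ (Fin n))}
    (hs : Bornology.IsBounded s) : (dyadicIndex j '' s).Finite := by
  obtain ⟨R, hR⟩ := hs.exists_norm_le
  refine (Set.Finite.pi' fun _ : Fin n =>
    Set.finite_Icc ⌊(2 : ℝ) ^ j * -R⌋ ⌊(2 : ℝ) ^ j * R⌋).subset ?_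
  rintro _ ⟨x, hx, rfl⟩ i
  have h1 := abs_le.1 ((PiLp.norm_apply_le x i).trans (hR x hx))
  constructor
  · exact Int.floor_le_floor (by gcongr; exact h1.1)
  · exact Int.floor_le_floor (by gcongr; exact h1.2)

theorem weightedIntegral_lt_top_of_forall_dyadicCube (j : ℤ)
    (h : ∀ m, weightedIntegral p W f (dyadicCube j m) ≠ ∞)
    {K : Set (EuclideanSpace ℝ (Fin n))} (hK : Bornology.IsBounded K) :
    weightedIntegral p W f K < ∞ := by
  simp only [weightedIntegral_eq] at h ⊢
  simp only [← withDensity_apply'] at h ⊢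
  refine (measure_mono ?_).trans_lt
    (measure_biUnion_lt_top (finite_image_dyadicIndex j hK) fun m _ => (h m).lt_top)
  intro x hx
  exact Set.mem_biUnion (Set.mem_image_of_mem _ hx) (mem_dyadicCube_iff.2 rfl)

/-- Uniform boundedness of the dyadic averages on the Bourgain–Morrey space. -/
theorem MatrixAp.bmNorm_dyadicAverage_le (hW : MatrixAp p W) (hp : 1 ≤ p) (hpt : p < t)
    (htr : t < r) {δ δ' : ℝ} (hδ : HasApDimension p W δ)
    (hδ' : 1 < p → HasApDimension (p / (p - 1)) (fun x => matPow (-(1 / (p - 1))) (W x)) δ')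
    (hcond : -((n : ℝ) * r / p) + δ * r / p + n
      - betaTilde n p δ' * r * (1 / t - 1 / p) < 0) :
    ∃ C : ℝ≥0∞, C ≠ ∞ ∧
      ∀ (a : ℤ) (g : EuclideanSpace ℝ (Fin n) → EuclideanSpace ℂ (Fin d)),
      AEStronglyMeasurable g → bmNorm p t r W (dyadicAverage a g) ≤ C * bmNorm p t r W g := by
  obtain ⟨c, hc, h⟩ := hW.cubeTerm_dyadicAverage_le hp hpt htr hδ hδ' hcond
  have hr : 0 ≤ 1 / r := by
    have : 0 < r := by linarith
    positivity
  refine ⟨_, ENNReal.rpow_ne_top_of_nonneg hr hc, fun a g hg => ?_⟩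
  rw [bmNorm_eq, bmNorm_eq, ← ENNReal.mul_rpow_of_nonneg _ _ hr, ← tsum_tsum_ancestor]
  exact ENNReal.rpow_le_rpow (ENNReal.tsum_le_tsum (h a g hg)) hr

theorem MemBM.dyadicAverage (hW : MatrixAp p W) (hp : 1 ≤ p) (hpt : p < t)
    (htr : t < r) {δ δ' : ℝ} (hδ : HasApDimension p W δ)
    (hδ' : 1 < p → HasApDimension (p / (p - 1)) (fun x => matPow (-(1 / (p - 1))) (W x)) δ')
    (hcond : -((n : ℝ) * r / p) + δ * r / p + n
      - betaTilde n p δ' * r * (1 / t - 1 / p) < 0) (hf : MemBM p t r W f) (a : ℤ) :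
    MemBM p t r W (dyadicAverage a f) where
  aestronglyMeasurable := aestronglyMeasurable_dyadicAverage a f
  locallyFinite K hK := by
    obtain ⟨C, hC, h⟩ := hδ.weightedIntegral_dyadicAverage_le hW.1 hp
    -- `K` meets finitely many cubes of the scale of the average
    refine weightedIntegral_lt_top_of_forall_dyadicCube (-a) (fun m => ?_) hK.isBounded
    have h1 := (h f hf.aestronglyMeasurable 0 (-a) m).2
    rw [Nat.cast_zero, add_zero, neg_neg] at h1
    exact ne_top_of_le_ne_top
      (ENNReal.mul_ne_top hC (hf.weightedIntegral_dyadicCube_ne_top _ _)) h1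
  norm_lt_top := by
    obtain ⟨C, hC, h⟩ := hW.bmNorm_dyadicAverage_le hp hpt htr hδ hδ' hcond
    exact (h a f hf.aestronglyMeasurable).trans_lt
      (ENNReal.mul_lt_top hC.lt_top hf.norm_lt_top)

theorem MemBM.tendsto_sub_dyadicAverage (hd : 0 < d) (hW : MatrixAp p W) (hp : 1 ≤ p)
    (hpt : p < t) (htr : t < r) {δ δ' : ℝ} (hδ : HasApDimension p W δ)
    (hδ' : 1 < p → HasApDimension (p / (p - 1)) (fun x => matPow (-(1 / (p - 1))) (W x)) δ')
    (hcond : -((n : ℝ) * r / p) + δ * r / p + n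
      - betaTilde n p δ' * r * (1 / t - 1 / p) < 0) (hf : MemBM p t r W f) :
    Tendsto (fun a : ℤ => bmNorm p t r W (f - BourgainMorrey.dyadicAverage a f)) atBot (𝓝 0) := by
  obtain ⟨c, hc, h⟩ := hW.cubeTerm_dyadicAverage_le hp hpt htr hδ hδ' hcond
  have hr : 1 ≤ r := by linarith
  have hr0 : 0 < r := by linarith
  have hp0 : 0 < p := by linarith
  have hfm := hf.aestronglyMeasurable
  have hS := tsum_cubeTerm_ne_top hr0 hf.norm_lt_top
  -- `(x + y) ^ r ≤ 2 ^ (r - 1) * (x ^ r + y ^ r)`, with the uniform bound for the terms of `E_a f`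
  refine tendsto_bmNorm_zero hr0
    (b := fun q => 2 ^ (r - 1) * (cubeTerm p t r W f q +
      ∑' k, c k * cubeTerm p t r W f (q.1 - k, ancestor k q.2))) ?_ (fun a q => ?_) fun q => ?_
  · rw [ENNReal.tsum_mul_left, ENNReal.tsum_add, tsum_tsum_ancestor]
    exact ENNReal.mul_ne_top (two_rpow_ne_top _)
      (ENNReal.add_ne_top.2 ⟨hS, ENNReal.mul_ne_top hc hS⟩)
  · refine le_trans ?_ (mul_le_mul_right (add_le_add_right (h a f hfm q) _) _)
    refine le_trans ?_ (ENNReal.rpow_add_le_mul_rpow_add_rpow _ _ hr)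
    rw [cubeTerm, ← mul_add, sub_eq_add_neg]
    gcongr
    rw [← weightedIntegral_neg (f := BourgainMorrey.dyadicAverage a f)]
    exact weightedIntegral_rpow_add_le hW.1 hp hfm
      (aestronglyMeasurable_dyadicAverage a f).neg _
  · exact tendsto_cubeTerm_zero hW.1 hd hp0 hr0 q
      (tendsto_weightedIntegral_sub_dyadicAverage hW.1 hp hδ hfm
        hf.weightedIntegral_dyadicCube_ne_top _ _)

/-- Each term of the sum vanishes once the ball contains the cube. -/
theorem MemBM.tendsto_indicator_compl_ball (hp : 0 < p) (hr : 0 < r) (hf : MemBM p t r W f) :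
    Tendsto (fun R : ℝ => bmNorm p t r W ((Metric.ball 0 R)ᶜ.indicator f)) atTop (𝓝 0) := by
  refine tendsto_bmNorm_zero hr (tsum_cubeTerm_ne_top hr hf.norm_lt_top) (fun R q => ?_)
    fun q => ?_
  · rw [cubeTerm, cubeTerm]
    gcongr
    exact weightedIntegral_indicator_le hp _ _
  · refine tendsto_const_nhds.congr' ?_
    have hb := isBounded_dyadicCube q.1 q.2
    obtain ⟨R₀, hR₀⟩ := hb.exists_norm_le
    filter_upwards [eventually_gt_atTop R₀] with R hR
    have h0 : weightedIntegral p W ((Metric.ball 0 R)ᶜ.indicator f) (dyadicCube q.1 q.2) = 0 := by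
      rw [weightedIntegral_congr (g := 0) (measurableSet_dyadicCube _ _) fun x hx => ?_]
      · simp [weightedIntegral_eq, wSize, hp]
      · refine Set.indicator_of_notMem (Set.notMem_compl_iff.2 ?_) f
        exact mem_ball_zero_iff.2 ((hR₀ x hx).trans_lt hR)
    rw [cubeTerm, h0, ENNReal.zero_rpow_of_pos (by positivity), mul_zero,
      ENNReal.zero_rpow_of_pos hr]

end Space

section FiniteNets

/-- Bounded sets for a seminorm on a finite-dimensional space have finite nets: the quotient by the
kernel of the seminorm is a proper normed space. -/
theorem _root_.Seminorm.exists_finite_net {E : Type*} [AddCommGroup E] [Module ℂ E]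
    [FiniteDimensional ℂ E] (q : Seminorm ℂ E) {S : Set E} {K : ℝ} (hS : ∀ x ∈ S, q x ≤ K)
    {ε : ℝ} (hε : 0 < ε) : ∃ N : Set E, N.Finite ∧ ∀ x ∈ S, ∃ y ∈ N, q (x - y) < ε := by
  let _ : SeminormedAddCommGroup E := q.toAddGroupSeminorm.toSeminormedAddCommGroup
  let _ : NormedSpace ℂ E := ⟨fun c x => (map_smul_eq_mul q c x).le⟩
  have hnorm : ∀ x : E, ‖x‖ = q x := fun x => rfl
  have : FiniteDimensional ℂ (SeparationQuotient E) :=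
    Module.Finite.of_surjective (SeparationQuotient.mkCLM ℂ E).toLinearMap
      SeparationQuotient.surjective_mk
  have : ProperSpace (SeparationQuotient E) := FiniteDimensional.proper ℂ _
  have htb : TotallyBounded S := by
    refine (totallyBounded_preimage SeparationQuotient.isUniformInducing_mk
      (isCompact_closedBall (0 : SeparationQuotient E) K).totallyBounded).subset fun x hx => ?_
    rw [Set.mem_preimage, mem_closedBall_zero_iff, SeparationQuotient.norm_mk]
    exact hS x hx
  obtain ⟨N, hN, hcov⟩ := Metric.totallyBounded_iff.1 htb ε hε
  refine ⟨N, hN, fun x hx => ?_⟩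
  obtain ⟨y, hy, hxy⟩ := Set.mem_iUnion₂.1 (hcov hx)
  refine ⟨y, hy, ?_⟩
  rw [← hnorm, ← dist_eq_norm]
  exact hxy

variable {n d : ℕ} {W : EuclideanSpace ℝ (Fin n) → Matrix (Fin d) (Fin d) ℂ} {p t r : ℝ}

/-- The Bourgain–Morrey space as a space of functions. -/
def bmSubmodule (t : ℝ) (hW : IsMatrixWeight W) (hp : 1 ≤ p) (hr : 1 ≤ r) :
    Submodule ℂ (EuclideanSpace ℝ (Fin n) → EuclideanSpace ℂ (Fin d)) where
  carrier := {f | MemBM p t r W f}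
  add_mem' hf hg := hf.add hW hp hr hg
  zero_mem' := by
    have hp0 : 0 < p := by linarith
    have hr0 : 0 < r := by linarith
    have h0 : ∀ E, weightedIntegral p W (0 : EuclideanSpace ℝ (Fin n) → EuclideanSpace ℂ (Fin d)) E
        = 0 := fun E => by simp [weightedIntegral_eq, wSize, hp0]
    exact ⟨aestronglyMeasurable_const, fun K _ => by simp [h0], by simp [bmNorm, h0, hp0, hr0]⟩
  smul_mem' c _ hf := hf.smul (by linarith) (by linarith) c

/-- The real-valued seminorm of the Bourgain–Morrey space. -/
def bmSeminorm (t : ℝ) (hW : IsMatrixWeight W) (hp : 1 ≤ p) (hr : 1 ≤ r) :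
    Seminorm ℂ (bmSubmodule t hW hp hr) :=
  Seminorm.of (fun f => (bmNorm p t r W f.1).toReal)
    (fun f g => by
      rw [← ENNReal.toReal_add f.2.norm_lt_top.ne g.2.norm_lt_top.ne]
      exact ENNReal.toReal_mono (ENNReal.add_ne_top.2 ⟨f.2.norm_lt_top.ne, g.2.norm_lt_top.ne⟩)
        (bmNorm_add_le hW hp hr f.2.aestronglyMeasurable g.2.aestronglyMeasurable))
    fun c f => by
      have h : bmNorm p t r W (c • f.1) = ‖c‖ₑ * bmNorm p t r W f.1 :=
        bmNorm_smul (by linarith) (by linarith) c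
      change (bmNorm p t r W (c • f.1)).toReal = _
      rw [h, ENNReal.toReal_mul, toReal_enorm]

/-- The step function that takes the value `v m` on the dyadic cube `Q_{j,m}`, `m ∈ J`, and
vanishes elsewhere. -/
def stepFunction (d : ℕ) (j : ℤ) (J : Finset (Fin n → ℤ)) :
    (J → EuclideanSpace ℂ (Fin d)) →ₗ[ℂ]
      (EuclideanSpace ℝ (Fin n) → EuclideanSpace ℂ (Fin d)) where
  toFun v x := if h : dyadicIndex j x ∈ J then v ⟨dyadicIndex j x, h⟩ else 0
  map_add' v w := by
    funext x
    by_cases h : dyadicIndex j x ∈ J <;> simp [h]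
  map_smul' c v := by
    funext x
    by_cases h : dyadicIndex j x ∈ J <;> simp [h]

theorem dyadicAverage_mem_range_stepFunction (a : ℤ) {J : Finset (Fin n → ℤ)}
    {f : EuclideanSpace ℝ (Fin n) → EuclideanSpace ℂ (Fin d)}
    (hf : ∀ x, dyadicIndex (-a) x ∉ J → f x = 0) :
    dyadicAverage a f ∈ LinearMap.range (stepFunction d (-a) J) := by
  refine ⟨fun m => ⨍ y in dyadicCube (-a) m.1, f y, funext fun x => ?_⟩
  rw [dyadicAverage_apply]
  by_cases h : dyadicIndex (-a) x ∈ J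
  · simp [stepFunction, h]
  · have h0 : ∫ y in dyadicCube (-a) (dyadicIndex (-a) x), f y = 0 := by
      refine setIntegral_eq_zero_of_forall_eq_zero fun y hy => hf y ?_
      rwa [mem_dyadicCube_iff.1 hy]
    simp [stepFunction, h, setAverage_eq, h0]

theorem exists_finite_net_of_mem_range_stepFunction (hW : IsMatrixWeight W) (hp : 1 ≤ p)
    (hr : 1 ≤ r) (j : ℤ) (J : Finset (Fin n → ℤ))
    {S : Set (EuclideanSpace ℝ (Fin n) → EuclideanSpace ℂ (Fin d))}
    (hS : ∀ u ∈ S, MemBM p t r W u ∧ u ∈ LinearMap.range (stepFunction d j J))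
    {K : ℝ≥0∞} (hK : K ≠ ∞) (hSK : ∀ u ∈ S, bmNorm p t r W u ≤ K) {ε : ℝ} (hε : 0 < ε) :
    ∃ N : Set (EuclideanSpace ℝ (Fin n) → EuclideanSpace ℂ (Fin d)), N.Finite ∧
      (∀ g ∈ N, MemBM p t r W g) ∧
      ∀ u ∈ S, ∃ g ∈ N, bmNorm p t r W (u - g) < ENNReal.ofReal ε := by
  let V : Submodule ℂ (bmSubmodule t hW hp hr) :=
    (LinearMap.range (stepFunction d j J)).comap (bmSubmodule t hW hp hr).subtype
  have : FiniteDimensional ℂ V := by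
    let L : V →ₗ[ℂ] LinearMap.range (stepFunction d j J) :=
      ((bmSubmodule t hW hp hr).subtype.comp V.subtype).codRestrict _ fun v => v.2
    refine Module.Finite.of_injective L fun v w h => ?_
    have h' : v.1.1 = w.1.1 := congrArg (fun z : LinearMap.range (stepFunction d j J) => z.1) h
    exact Subtype.ext (Subtype.ext h')
  let q : Seminorm ℂ V := (bmSeminorm t hW hp hr).comp V.subtype
  obtain ⟨N, hN, hcov⟩ := q.exists_finite_net
    (S := {v : V | v.1.1 ∈ S}) (K := K.toReal) (fun v hv => ENNReal.toReal_mono hK (hSK _ hv)) hε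
  refine ⟨(fun v : V => v.1.1) '' N, hN.image _, ?_, fun u hu => ?_⟩
  · rintro _ ⟨v, -, rfl⟩
    exact v.1.2
  · obtain ⟨y, hy, hlt⟩ := hcov ⟨⟨u, (hS u hu).1⟩, (hS u hu).2⟩ hu
    refine ⟨_, Set.mem_image_of_mem _ hy, ?_⟩
    exact (ENNReal.lt_ofReal_iff_toReal_lt ((hS u hu).1.sub hW hp hr y.1.2).norm_lt_top.ne).2 hlt

end FiniteNets

/-! ### Total boundedness -/

section Criterion
variable {n d : ℕ} {W : EuclideanSpace ℝ (Fin n) → Matrix (Fin d) (Fin d) ℂ} {p t r : ℝ}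
  {F : Set (EuclideanSpace ℝ (Fin n) → EuclideanSpace ℂ (Fin d))}

/-- Uniformly bounded maps `T i` for which `‖T i g‖ → 0` at every `g` of the space converge to
zero uniformly on totally bounded sets. -/
theorem TotallyBoundedBM.tendsto_iSup_bmNorm (h : TotallyBoundedBM p t r W F)
    (hF : ∀ f ∈ F, MemBM p t r W f) {ι : Type*} {l : Filter ι}
    (T : ι → (EuclideanSpace ℝ (Fin n) → EuclideanSpace ℂ (Fin d)) →
      EuclideanSpace ℝ (Fin n) → EuclideanSpace ℂ (Fin d)) {C : ℝ≥0∞} (hC : C ≠ ∞)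
    (hT : ∀ i f g, MemBM p t r W f → MemBM p t r W g →
      bmNorm p t r W (T i f) ≤ C * bmNorm p t r W (f - g) + bmNorm p t r W (T i g))
    (hlim : ∀ g, MemBM p t r W g → Tendsto (fun i => bmNorm p t r W (T i g)) l (𝓝 0)) :
    Tendsto (fun i => ⨆ f ∈ F, bmNorm p t r W (T i f)) l (𝓝 0) := by
  rw [ENNReal.tendsto_nhds_zero]
  intro ε hε
  obtain ⟨η, hη0, hη⟩ := ENNReal.lt_iff_exists_real_btwn.1
    (ENNReal.div_pos hε.ne' (ENNReal.add_ne_top.2 ⟨hC, ENNReal.one_ne_top⟩) : 0 < ε / (C + 1))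
  have hηpos : 0 < η := ENNReal.ofReal_pos.1 hη.1
  obtain ⟨N, hN, hNm, hcov⟩ := h η hηpos
  filter_upwards [(eventually_all_finite hN).2 fun g hg =>
    ENNReal.tendsto_nhds_zero.1 (hlim g (hNm g hg)) _ hη.1] with i hi
  refine iSup₂_le fun f hf => ?_
  obtain ⟨g, hg, hfg⟩ := hcov f hf
  calc bmNorm p t r W (T i f) ≤ C * bmNorm p t r W (f - g) + bmNorm p t r W (T i g) :=
        hT i f g (hF f hf) (hNm g hg)
    _ ≤ C * ENNReal.ofReal η + ENNReal.ofReal η := by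
        gcongr
        exact hi g hg
    _ = (C + 1) * ENNReal.ofReal η := by ring
    _ ≤ ε := by
        rw [mul_comm]
        exact (ENNReal.le_div_iff_mul_le (by simp)
          (Or.inl (ENNReal.add_ne_top.2 ⟨hC, ENNReal.one_ne_top⟩))).1 hη.2.le

theorem TotallyBoundedBM.iSup_bmNorm_lt_top (hW : IsMatrixWeight W) (hp : 1 ≤ p) (hr : 1 ≤ r)
    (h : TotallyBoundedBM p t r W F) (hF : ∀ f ∈ F, MemBM p t r W f) :
    (⨆ f ∈ F, bmNorm p t r W f) < ∞ := by
  obtain ⟨N, hN, hNm, hcov⟩ := h 1 one_pos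
  have hsum : (∑ g ∈ hN.toFinset, bmNorm p t r W g) < ∞ :=
    ENNReal.sum_lt_top.2 fun g hg => (hNm g (hN.mem_toFinset.1 hg)).norm_lt_top
  refine lt_of_le_of_lt (iSup₂_le fun f hf => ?_)
    (ENNReal.add_lt_top.2 ⟨ENNReal.ofReal_lt_top (r := 1), hsum⟩)
  obtain ⟨g, hg, hfg⟩ := hcov f hf
  calc bmNorm p t r W f = bmNorm p t r W ((f - g) + g) := by rw [sub_add_cancel]
    _ ≤ bmNorm p t r W (f - g) + bmNorm p t r W g :=
        bmNorm_add_le hW hp hr ((hF f hf).aestronglyMeasurable.sub (hNm g hg).aestronglyMeasurable)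
          (hNm g hg).aestronglyMeasurable
    _ ≤ _ := add_le_add hfg.le
        (Finset.single_le_sum (f := fun g => bmNorm p t r W g) (fun _ _ => zero_le)
          (hN.mem_toFinset.2 hg))

end Criterion

end BourgainMorrey

end

theorem theorem4 {n d : ℕ} (hn : 0 < n) (hd : 0 < d) (p t r : ℝ)
    (hp : 1 ≤ p) (hpt : p < t) (htr : t < r)
    (W : EuclideanSpace ℝ (Fin n) → Matrix (Fin d) (Fin d) ℂ) (hW : MatrixAp p W)
    (δ : ℝ) (hδ0 : 0 ≤ δ) (hδn : δ < n) (hδ : HasApDimension p W δ)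
    (δ' : ℝ)
    (hδ' : 1 < p → HasApDimension (p / (p - 1)) (fun x => matPow (-(1 / (p - 1))) (W x)) δ')
    (hcond : -((n : ℝ) * r / p) + δ * r / p + n
      - betaTilde n p δ' * r * (1 / t - 1 / p) < 0)
    (F : Set (EuclideanSpace ℝ (Fin n) → EuclideanSpace ℂ (Fin d)))
    (hF : ∀ f ∈ F, MemBM p t r W f) :
    TotallyBoundedBM p t r W F ↔
      ((⨆ f ∈ F, bmNorm p t r W f) < ∞ ∧
        Tendsto (fun R : ℝ => ⨆ f ∈ F, bmNorm p t r W ((Metric.ball 0 R)ᶜ.indicator f))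
          atTop (𝓝 0) ∧
        Tendsto (fun a : ℤ => ⨆ f ∈ F, bmNorm p t r W (f - dyadicAverage a f))
          atBot (𝓝 0)) := by
  have hr : 1 ≤ r := by linarith
  have hr0 : 0 < r := by linarith
  have hp0 : 0 < p := by linarith
  have hWm := hW.1
  obtain ⟨C, hC, hav⟩ := hW.bmNorm_dyadicAverage_le hp hpt htr hδ hδ' hcond
  constructor
  · intro h
    refine ⟨h.iSup_bmNorm_lt_top hWm hp hr hF, ?_, ?_⟩
    · refine h.tendsto_iSup_bmNorm hF (fun R f => (Metric.ball 0 R)ᶜ.indicator f)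
        ENNReal.one_ne_top (fun R f g hf hg => ?_)
        fun g hg => hg.tendsto_indicator_compl_ball hp0 hr0
      have hs : MeasurableSet (Metric.ball (0 : EuclideanSpace ℝ (Fin n)) R)ᶜ :=
        measurableSet_ball.compl
      have hfg := hf.sub hWm hp hr hg
      have hdec : (Metric.ball 0 R)ᶜ.indicator f =
          (Metric.ball 0 R)ᶜ.indicator (f - g) + (Metric.ball 0 R)ᶜ.indicator g := by
        rw [← Set.indicator_add', sub_add_cancel]
      rw [one_mul, hdec]
      refine (bmNorm_add_le hWm hp hr (hfg.aestronglyMeasurable.indicator hs)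
        (hg.aestronglyMeasurable.indicator hs)).trans ?_
      gcongr
      exact bmNorm_indicator_le hp0 hr0 _
    · refine h.tendsto_iSup_bmNorm hF (fun a f => f - dyadicAverage a f)
        (C := 1 + C) (ENNReal.add_ne_top.2 ⟨ENNReal.one_ne_top, hC⟩) (fun a f g hf hg => ?_)
        fun g hg => hg.tendsto_sub_dyadicAverage hd hW hp hpt htr hδ hδ' hcond
      have hfg := (hf.sub hWm hp hr hg).aestronglyMeasurable
      have hgm := hg.aestronglyMeasurable
      have hdec : f - dyadicAverage a f =
          ((f - g) - dyadicAverage a (f - g)) + (g - dyadicAverage a g) := by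
        rw [dyadicAverage_sub (hf.integrableOn hWm hp hδ) (hg.integrableOn hWm hp hδ)]
        abel
      rw [hdec]
      refine (bmNorm_add_le hWm hp hr (hfg.sub (aestronglyMeasurable_dyadicAverage _ _))
        (hgm.sub (aestronglyMeasurable_dyadicAverage _ _))).trans ?_
      gcongr
      refine (bmNorm_sub_le hWm hp hr hfg (aestronglyMeasurable_dyadicAverage _ _)).trans ?_
      rw [add_mul, one_mul]
      gcongr
      exact hav a _ hfg
  · rintro ⟨hbdd, htail, hosc⟩ ε hε
    have hε3 : 0 < ε / 3 := by positivity
    have hε3' : 0 < ENNReal.ofReal (ε / 3) := ENNReal.ofReal_pos.2 hε3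
    have hC1 : C + 1 ≠ ∞ := ENNReal.add_ne_top.2 ⟨hC, ENNReal.one_ne_top⟩
    obtain ⟨a, ha⟩ := (ENNReal.tendsto_nhds_zero.1 hosc _ hε3').exists
    obtain ⟨R, hR⟩ := (ENNReal.tendsto_nhds_zero.1 htail _ (ENNReal.div_pos hε3'.ne' hC1)).exists
    set B : Set (EuclideanSpace ℝ (Fin n)) := Metric.ball 0 R with hB
    have hBm : MeasurableSet B := measurableSet_ball
    let J : Finset (Fin n → ℤ) :=
      (finite_image_dyadicIndex (-a) (Metric.isBounded_ball (x := 0) (r := R))).toFinset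
    have hJ : ∀ (f : EuclideanSpace ℝ (Fin n) → EuclideanSpace ℂ (Fin d)) (x),
        dyadicIndex (-a) x ∉ J → B.indicator f x = 0 := fun f x hx =>
      Set.indicator_of_notMem (fun hxB => hx ((Set.Finite.mem_toFinset _).2 ⟨x, hxB, rfl⟩)) f
    obtain ⟨N, hN, hNm, hcov⟩ := exists_finite_net_of_mem_range_stepFunction hWm hp hr (-a) J
      (S := (fun f => dyadicAverage a (B.indicator f)) '' F)
      (K := C * ⨆ f ∈ F, bmNorm p t r W f) (t := t)
      (by
        rintro _ ⟨f, hf, rfl⟩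
        exact ⟨((hF f hf).indicator hp0 hr0 hBm).dyadicAverage hW hp hpt htr hδ hδ' hcond a,
          dyadicAverage_mem_range_stepFunction a (hJ f)⟩)
      (ENNReal.mul_ne_top hC hbdd.ne)
      (by
        rintro _ ⟨f, hf, rfl⟩
        refine (hav a _ ((hF f hf).aestronglyMeasurable.indicator hBm)).trans ?_
        gcongr
        exact (bmNorm_indicator_le hp0 hr0 _).trans (le_iSup₂_of_le f hf le_rfl)) hε3
    refine ⟨N, hN, hNm, fun f hf => ?_⟩
    obtain ⟨g, hg, hlt⟩ := hcov _ (Set.mem_image_of_mem _ hf)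
    refine ⟨g, hg, ?_⟩
    have hfB := (hF f hf).indicator hp0 hr0 hBm
    have hfm := (hF f hf).aestronglyMeasurable
    have hsub : dyadicAverage a (Bᶜ.indicator f) =
        dyadicAverage a f - dyadicAverage a (B.indicator f) := by
      rw [Set.indicator_compl, dyadicAverage_sub ((hF f hf).integrableOn hWm hp hδ)
        (hfB.integrableOn hWm hp hδ)]
    -- the three terms are controlled by (iii), by (ii) and the bound for `E_a`, and by the net
    have hdec : f - g = (f - dyadicAverage a f) +
        (dyadicAverage a (Bᶜ.indicator f) + (dyadicAverage a (B.indicator f) - g)) := by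
      rw [hsub]
      abel
    have h1 : bmNorm p t r W (f - dyadicAverage a f) ≤ ENNReal.ofReal (ε / 3) :=
      le_trans (le_iSup₂_of_le f hf le_rfl) ha
    have h2 : bmNorm p t r W (dyadicAverage a (Bᶜ.indicator f)) ≤ ENNReal.ofReal (ε / 3) := by
      have h3 : bmNorm p t r W (Bᶜ.indicator f) ≤ ENNReal.ofReal (ε / 3) / (C + 1) :=
        le_trans (le_iSup₂_of_le f hf le_rfl) hR
      calc _ ≤ C * bmNorm p t r W (Bᶜ.indicator f) := hav a _ (hfm.indicator hBm.compl)
        _ ≤ (C + 1) * (ENNReal.ofReal (ε / 3) / (C + 1)) := by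
            gcongr
            exact le_self_add
        _ = _ := ENNReal.mul_div_cancel (by simp) hC1
    have hm3 : AEStronglyMeasurable (dyadicAverage a (B.indicator f) - g) :=
      (aestronglyMeasurable_dyadicAverage _ _).sub (hNm g hg).aestronglyMeasurable
    calc bmNorm p t r W (f - g)
        ≤ bmNorm p t r W (f - dyadicAverage a f) +
          (bmNorm p t r W (dyadicAverage a (Bᶜ.indicator f)) +
            bmNorm p t r W (dyadicAverage a (B.indicator f) - g)) := by
          rw [hdec]
          refine (bmNorm_add_le hWm hp hr (hfm.sub (aestronglyMeasurable_dyadicAverage _ _))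
            ((aestronglyMeasurable_dyadicAverage _ _).add hm3)).trans ?_
          gcongr
          exact bmNorm_add_le hWm hp hr (aestronglyMeasurable_dyadicAverage _ _) hm3
      _ < ENNReal.ofReal (ε / 3) + (ENNReal.ofReal (ε / 3) + ENNReal.ofReal (ε / 3)) :=
          ENNReal.add_lt_add_of_le_of_lt (ne_top_of_le_ne_top ENNReal.ofReal_ne_top h1) h1
            (ENNReal.add_lt_add_of_le_of_lt (ne_top_of_le_ne_top ENNReal.ofReal_ne_top h2) h2 hlt)
      _ = ENNReal.ofReal ε := by
          rw [← ENNReal.ofReal_add hε3.le hε3.le, ← ENNReal.ofReal_add hε3.le (by positivity)]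
          ring_nf
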